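/- Let $n_0, L, n_1,\dots,n_L, K$ be natural numbers and consider a fully-connected feed-forward network $\mathcal N$ with $n_0$ inputs and $L$ hidden layers of widths $n_1,\dots,n_L$, all of whose $N=n_1+\cdots+n_L$ hidden units are rank-$K$ maxout units: if $a$ is the vector of activations of the preceding layer (the network input $x\in\mathbb R^{n_0}$ for the first layer), unit $z$ outputs $\max_{k\in[K]}\zeta_{z,k}$ with $\zeta_{z,k}=w_{z,k}\cdot a+b_{z,k}$. Write $\theta$ for the collection of all weights $w_{z,k}$ and biases $b_{z,k}$, and $\zeta_{z,k}(x;\theta)$ for the pre-activation features as functions of the network input $x$. An $r$-partial activation pattern is a family $J=(J_z)_z$ of non-empty sets $J_z\subseteq[K]$, one for each unit $z$, with $\sum_z(|J_z|-1)=r$; let $$\mathcal R(J,\theta)=\{x\in\mathbb R^{n_0} : \operatorname{argmax}_{k\in[K]}\zeta_{z,k}(x;\theta)=J_z \text{ for every unit } z\},$$ and let $\mathcal X_{\mathcal N,r}(\theta)$ be the union of the sets $\mathcal R(J,\theta)$ over all $r$-partial activation patterns $J$. Let $S\subset\mathbb R^{n_0}$ be bounded and measurable, and let $\theta$ be random with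 a distribution such that: 1. the joint distribution of all weights has a density with respect to Lebesgue measure; 2. every collection of biases has a conditional density with respect to Lebesgue measure given the values of all weights and all other biases; 3. $C_{\rm grad}>0$ is a constant such that $\sup_{x\in S}\mathbb E\big[\|\nabla_x\zeta_{z,k}(x;\theta)\|^t\big]\le C_{\rm grad}^t$ for every $t\in\mathbb N$ and every pre-activation feature $\zeta_{z,k}$; 4. $C_{\rm bias}>0$ is a constant such that, for every $t$ and any $t$ distinct pre-activation features from any units, the conditional density $\rho_{b_1,\dots,b_t}$ of their biases given all weights and all other biases satisfies $\sup_{b_1,\dots,b_t}\rho_{b_1,\dots,b_t}(b_1,\dots,b_t)\le C_{\rm bias}^t$ (almost surely, with the essential supremum). Then for every $r\in\{1,\dots,n_0\}$ with $r\le N$, the $(n_0-r)$-dimensional (Hausdorff) volume $\operatorname{vol}_{n_0-r}(\mathcal X_{\mathcal N,r}(\theta)\cap S)$ is a measurable function of $\theta$ up to a null set, and $$\frac{\mathbb E\big[\operatorname{vol}_{n_0-r}(\mathcal X_{\mathcal N,r}\cap S)\big]}{\operatorname{vol}_{n_0}(S)}\le(2\,C_{\rm grad}\,C_{\rm bias})^r\binom{rK}{2r}\binom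 Nr ,$$ where for $\operatorname{vol}_{n_0}(S)=0$ the inequality means that the expectation is $0$. -/

import Mathlib

open MeasureTheory

noncomputable section

namespace Maxout

variable {L : ℕ}

/-- The hidden units of a network with `L` hidden layers, where `n 0` is the input dimension and
`n l.succ` is the width of the hidden layer with (zero-based) index `l : Fin L`. -/
abbrev HiddenUnit (n : Fin (L + 1) → ℕ) : Type :=
  Σ l : Fin L, Fin (n l.succ)

/-- The total number `N = n₁ + ⋯ + n_L` of hidden units. -/
def numUnits (n : Fin (L + 1) → ℕ) : ℕ :=
  ∑ l : Fin L, n l.succ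

/-- Indices of the weights: the weight `⟨l, i, k, j⟩` connects unit `j` of the preceding layer to
the `k`-th pre-activation feature of unit `i` of hidden layer `l`. -/
abbrev WeightIndex (n : Fin (L + 1) → ℕ) (K : ℕ) : Type :=
  Σ l : Fin L, Fin (n l.succ) × Fin K × Fin (n l.castSucc)

/-- Indices of the biases: one bias for every pre-activation feature of every hidden unit. -/
abbrev BiasIndex (n : Fin (L + 1) → ℕ) (K : ℕ) : Type :=
  HiddenUnit n × Fin K

/-- The parameters `θ = (weights, biases)` of the hidden layers. -/
abbrev Params (n : Fin (L + 1) → ℕ) (K : ℕ) : Type :=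
  (WeightIndex n K → ℝ) × (BiasIndex n K → ℝ)

/-- The affine function of the activation values `a` of the preceding layer which is the `k`-th
argument of the maximum computed by the unit `i` of hidden layer `l`. -/
def affineFeature {n : Fin (L + 1) → ℕ} {K : ℕ} (θ : Params n K) (l : Fin L)
    (a : Fin (n l.castSucc) → ℝ) (i : Fin (n l.succ)) (k : Fin K) : ℝ :=
  (∑ j, θ.1 ⟨l, i, k, j⟩ * a j) + θ.2 (⟨l, i⟩, k)

/-- The activation values of layer `l` (layer `0` is the input layer) on the input `x`; each
hidden unit outputs the maximum of its `K` affine features. -/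
def activation {n : Fin (L + 1) → ℕ} {K : ℕ} (θ : Params n K)
    (x : EuclideanSpace ℝ (Fin (n 0))) (l : Fin (L + 1)) : Fin (n l) → ℝ :=
  Fin.induction (motive := fun l => Fin (n l) → ℝ) (fun i => x i)
    (fun l a i => ⨆ k : Fin K, affineFeature θ l a i k) l

/-- The pre-activation feature `ζ_{z,k}(x; θ)` as a function of the network input `x`. -/
def feature {n : Fin (L + 1) → ℕ} {K : ℕ} (θ : Params n K) (z : HiddenUnit n) (k : Fin K)
    (x : EuclideanSpace ℝ (Fin (n 0))) : ℝ :=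
  affineFeature θ z.1 (activation θ x z.1.castSucc) z.2 k

/-- The set `𝒫_r` of `r`-partial activation patterns: assignments of a non-empty set
`J z ⊆ [K]` to every unit `z` with `∑ z, (|J z| - 1) = r`. -/
def partialPatterns (n : Fin (L + 1) → ℕ) (K r : ℕ) : Set (HiddenUnit n → Finset (Fin K)) :=
  {J | (∀ z, (J z).Nonempty) ∧ ∑ z, ((J z).card - 1) = r}

/-- The activation region `ℛ(J, θ)`: the inputs `x` such that, for every unit `z`,
`argmax_k ζ_{z,k}(x; θ) = J z`. -/
def activationRegion {n : Fin (L + 1) → ℕ} {K : ℕ} (θ : Params n K)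
    (J : HiddenUnit n → Finset (Fin K)) : Set (EuclideanSpace ℝ (Fin (n 0))) :=
  {x | ∀ z, {k : Fin K | ∀ j : Fin K, feature θ z j x ≤ feature θ z k x} = (J z : Set (Fin K))}

/-- The union `𝒳_{𝒩,r}(θ)` of all `r`-partial activation regions. -/
def partialLocus {n : Fin (L + 1) → ℕ} {K : ℕ} (θ : Params n K) (r : ℕ) :
    Set (EuclideanSpace ℝ (Fin (n 0))) :=
  ⋃ J ∈ partialPatterns n K r, activationRegion θ J

/-- The splitting of a parameter into (all weights and all biases outside the collection `T`,
the biases in the collection `T`). -/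
def splitParams {n : Fin (L + 1) → ℕ} {K : ℕ} (T : Finset (BiasIndex n K)) (θ : Params n K) :
    ((WeightIndex n K → ℝ) × ({i // i ∉ T} → ℝ)) × ({i // i ∈ T} → ℝ) :=
  ((θ.1, fun i => θ.2 i), fun i => θ.2 i)

/-- The law, under `P`, of all weights and all biases outside the collection `T`. -/
def restLaw {n : Fin (L + 1) → ℕ} {K : ℕ} (P : Measure (Params n K))
    (T : Finset (BiasIndex n K)) :
    Measure ((WeightIndex n K → ℝ) × ({i // i ∉ T} → ℝ)) :=
  P.map fun θ => (splitParams T θ).1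

/-- `ρ` is (a version of) the conditional density, with respect to Lebesgue measure, of the biases
in the collection `T` given all weights and all other biases: `ρ (o, b)` is the conditional
density at `b` given the value `o` of the remaining parameters. -/
def IsBiasCondDensity {n : Fin (L + 1) → ℕ} {K : ℕ} (P : Measure (Params n K))
    (T : Finset (BiasIndex n K))
    (ρ : ((WeightIndex n K → ℝ) × ({i // i ∉ T} → ℝ)) × ({i // i ∈ T} → ℝ) → ENNReal) : Prop :=
  Measurable ρ ∧
    P.map (splitParams T) =
      ((restLaw P T).prod (volume : Measure ({i // i ∈ T} → ℝ))).withDensity ρ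

end Maxout

end

/-!
# Expected volume of the non-linear locus of a random maxout network

If every unit `z` outputs a fixed feature `sel z` instead of the maximum, all features become affine
functions of the input (`selFeature`, with gradient `selGrad` depending on the weights only). On the
activation region of a pattern `J` this affine network agrees with the maxout network whenever
`sel z ∈ J z`. Let `base z` be the smallest element of `J z`, and let `T` be the set of the biases of
the remaining features in `J`; for an `r`-partial pattern it has `r` elements. The biases in `T` do
not influence the outputs of the affine network given by `base`, so that on the region of `J` the
ties are `r` equations `⟪tieGrad i, x⟫ + tieConst i + b i = 0`, `i ∈ T`, whose coefficients depend
only on the parameters `o` outside `T`. In particular, `o` and `x` determine the biases in `T`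
(`eq_tieBias`), and the region of `J` for `(o, b)` is the fibre over `b` of an affine map, restricted
to a set `tieDomain` which does not depend on `b`. By the coarea formula, the integral over `b` of
the volumes of these fibres is a Jacobian times the volume of `tieDomain`
(`lintegral_activationRegion_le`). As the conditional density of the biases in `T` is at most
`Cbias ^ r`, it remains to bound the Jacobian and to add up over all patterns.

The Jacobian has to be bounded for the particular biases that produce the ties, whereas the gradient
hypothesis concerns random biases. But bounds `Cgrad ^ t` for the moments of every order `t` are a
bound for the essential supremum, so for almost every parameter the gradients are bounded by `Cgrad`
almost everywhere on `S` (`ae_mem_boundedGrad`). Almost every point `x` of `S` lies in a polyhedral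
cell which meets `S` in positive volume, on which the network is affine with some choice of branches
`sel` (`exists_cell_of_forall_nhds`), so that the gradients for this choice are bounded. Passing from
`base` to `sel` changes the gradient of each tie by a combination of the gradients of ties in
preceding layers (`selGrad_sub_mem_span`), which by Gram–Schmidt orthogonalization does not affect
the Jacobian (`lintegral_fiber_le`). Hence the Jacobian is at most `(2 * Cgrad) ^ r`.

For the sum, assign to each `r`-partial pattern a set `U` of `r` units containing all its ties; the
units in `U` then have `2 * r` features in the pattern, so there are at most
`(N choose r) * (r * K choose 2 * r)` possibilities for `U` and these features. Patterns with the
same `U` and the same features have the same `T`, and for fixed `o` their sets `tieDomain` are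
disjoint, since the input and `o` determine the pattern (`pattern_unique`). So all of them together
contribute at most `(2 * Cgrad * Cbias) ^ r * volume S`.

The volume of a region is measurable in the parameters because, up to a constant, it is the
`n 0`-dimensional volume of the region thickened by a unit ball in the directions orthogonal to the
tie equations (`volume_thickening`, `aemeasurable_section_volume`).
-/

noncomputable section

namespace Maxout

/-! ### Orthonormal frames and the coarea inequality for affine maps -/

section Frame

variable {d r m : ℕ}

/-- The coordinates of `EuclideanSpace ℝ (Fin d)` in an orthonormal basis whose index set is split
into two blocks, as a measurable equivalence with a product of coordinate spaces. -/
def frameEquiv (u : OrthonormalBasis (Fin r ⊕ Fin m) ℝ (EuclideanSpace ℝ (Fin d))) :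
    (Fin r → ℝ) × (Fin m → ℝ) ≃ᵐ EuclideanSpace ℝ (Fin d) :=
  ((MeasurableEquiv.sumPiEquivProdPi fun _ : Fin r ⊕ Fin m => ℝ).symm.trans
    (MeasurableEquiv.toLp 2 (Fin r ⊕ Fin m → ℝ))).trans
    u.repr.symm.toHomeomorph.toMeasurableEquiv

variable (u : OrthonormalBasis (Fin r ⊕ Fin m) ℝ (EuclideanSpace ℝ (Fin d)))

lemma frameEquiv_apply (s : Fin r → ℝ) (y : Fin m → ℝ) :
    frameEquiv u (s, y) = ∑ i, s i • u (Sum.inl i) + ∑ j, y j • u (Sum.inr j) := by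
  have : frameEquiv u (s, y) = u.repr.symm (WithLp.toLp 2 (Sum.elim s y)) := by
    rfl
  rw [this, ← u.sum_repr_symm, Fintype.sum_sum_type]
  simp

lemma measurePreserving_frameEquiv : MeasurePreserving (frameEquiv u) volume volume :=
  ((volume_measurePreserving_sumPiEquivProdPi_symm fun _ : Fin r ⊕ Fin m => ℝ).trans
    (PiLp.volume_preserving_toLp _)).trans u.measurePreserving_repr_symm

lemma inner_frameEquiv_inl (s : Fin r → ℝ) (y : Fin m → ℝ) (i : Fin r) :
    inner ℝ (u (Sum.inl i)) (frameEquiv u (s, y)) = s i := by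
  simp [frameEquiv_apply, inner_add_right, inner_sum, inner_smul_right, u.inner_eq_ite]

/-- Slices of a set by the first block of coordinates have the volume of their coordinate
images. -/
lemma euclideanHausdorffMeasure_slice (Z : Set (EuclideanSpace ℝ (Fin d))) (s : Fin r → ℝ) :
    μHE[m] {x ∈ Z | ∀ i, inner ℝ (u (Sum.inl i)) x = s i} =
      volume {y | frameEquiv u (s, y) ∈ Z} := by
  let ψ : EuclideanSpace ℝ (Fin m) → EuclideanSpace ℝ (Fin d) :=
    fun y => frameEquiv u (s, y.ofLp)
  have hψ : Isometry ψ := by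
    refine Isometry.of_dist_eq fun y y' => ?_
    rw [dist_eq_norm, dist_eq_norm]
    have h1 : ψ y - ψ y' = frameEquiv u (0, y.ofLp - y'.ofLp) := by
      simp [ψ, frameEquiv_apply, sub_smul, Finset.sum_sub_distrib]
    have h2 : frameEquiv u (0, y.ofLp - y'.ofLp)
        = u.repr.symm (WithLp.toLp 2 (Sum.elim 0 (y.ofLp - y'.ofLp))) := rfl
    rw [h1, h2, LinearIsometryEquiv.norm_map, EuclideanSpace.norm_eq, EuclideanSpace.norm_eq,
      Fintype.sum_sum_type]
    simp
  have himg : {x ∈ Z | ∀ i, inner ℝ (u (Sum.inl i)) x = s i} =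
      ψ '' (WithLp.ofLp ⁻¹' {y | frameEquiv u (s, y) ∈ Z}) := by
    ext x
    constructor
    · rintro ⟨hx, hs⟩
      obtain ⟨⟨s', y⟩, rfl⟩ := (frameEquiv u).surjective x
      obtain rfl : s' = s := funext fun i => by rw [← hs i, inner_frameEquiv_inl]
      exact ⟨WithLp.toLp 2 y, hx, rfl⟩
    · rintro ⟨y, hy, rfl⟩
      exact ⟨hy, fun i => inner_frameEquiv_inl u s _ i⟩
  rw [himg, hψ.euclideanHausdorffMeasure_image, EuclideanSpace.euclideanHausdorffMeasure_eq_volume]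
  exact (PiLp.volume_preserving_ofLp (Fin m)).measure_preimage_equiv
    (f := (MeasurableEquiv.toLp 2 (Fin m → ℝ)).symm) _

/-- The Gram–Schmidt process gives an orthonormal basis in which the vectors `g i` are
triangular. -/
lemma exists_orthonormalBasis_triangular (hd : r + m = d)
    (g : Fin r → EuclideanSpace ℝ (Fin d)) :
    ∃ u : OrthonormalBasis (Fin r ⊕ Fin m) ℝ (EuclideanSpace ℝ (Fin d)),
      (∀ i j, i < j → inner ℝ (u (Sum.inl j)) (g i) = 0) ∧
      ∀ i j, inner ℝ (u (Sum.inr j)) (g i) = 0 := by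
  subst hd
  let f : Fin (r + m) → EuclideanSpace ℝ (Fin (r + m)) := Fin.addCases g 0
  have hf : ∀ i, f (Fin.castAdd m i) = g i := fun i => by simp [f]
  let b := InnerProductSpace.gramSchmidtOrthonormalBasis (𝕜 := ℝ)
    (by simp : Module.finrank ℝ (EuclideanSpace ℝ (Fin (r + m))) = Fintype.card (Fin (r + m))) f
  refine ⟨b.reindex finSumFinEquiv.symm, fun i j hij => ?_, fun i j => ?_⟩
  · rw [← hf i, OrthonormalBasis.reindex_apply]
    exact InnerProductSpace.gramSchmidtOrthonormalBasis_inv_triangular _ _ 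
      (by simpa using show Fin.castAdd m i < Fin.castAdd m j from hij)
  · rw [← hf i, OrthonormalBasis.reindex_apply]
    refine InnerProductSpace.gramSchmidtOrthonormalBasis_inv_triangular _ _ ?_
    rw [Fin.lt_def]
    simp
    omega

/-- The matrix which turns the first block of coordinates of `x` into the inner products of
`x` with the vectors `g i`, when these are orthogonal to the second block of basis vectors. -/
def frameMatrix (g : Fin r → EuclideanSpace ℝ (Fin d)) : Matrix (Fin r) (Fin r) ℝ :=
  Matrix.of fun i j => inner ℝ (u (Sum.inl j)) (g i)

lemma inner_frameEquiv (g : Fin r → EuclideanSpace ℝ (Fin d))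
    (hg : ∀ i j, inner ℝ (u (Sum.inr j)) (g i) = 0) (s : Fin r → ℝ) (y : Fin m → ℝ) (i : Fin r) :
    inner ℝ (g i) (frameEquiv u (s, y)) = (Matrix.toLin' (frameMatrix u g)) s i := by
  rw [real_inner_comm]
  simp [frameEquiv_apply, inner_add_left, sum_inner, inner_smul_left, hg, frameMatrix, Matrix.mulVec,
    dotProduct, mul_comm]

lemma det_frameMatrix (g : Fin r → EuclideanSpace ℝ (Fin d))
    (hg : ∀ i j, i < j → inner ℝ (u (Sum.inl j)) (g i) = 0) :
    (frameMatrix u g).det = ∏ i, inner ℝ (u (Sum.inl i)) (g i) := by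
  rw [← Matrix.det_transpose]
  exact Matrix.det_of_isUpperTriangular fun i j hij => hg j i hij

/-- The coarea formula for a linear map, with respect to an adapted orthonormal basis. -/
lemma lintegral_fiber_eq (g : Fin r → EuclideanSpace ℝ (Fin d))
    (hg : ∀ i j, inner ℝ (u (Sum.inr j)) (g i) = 0)
    {D : Set (EuclideanSpace ℝ (Fin d))} (hD : MeasurableSet D) :
    ∫⁻ b : Fin r → ℝ, μHE[m] {x ∈ D | ∀ i, inner ℝ (g i) x = b i} =
      ENNReal.ofReal |(frameMatrix u g).det| * volume D := by
  set A := Matrix.toLin' (frameMatrix u g) with hA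
  have hdet : LinearMap.det A = (frameMatrix u g).det := LinearMap.det_toLin' _
  rw [← hdet]
  by_cases h0 : LinearMap.det A = 0
  · -- the fibres over points outside the proper subspace `range A` are empty
    have hrange : LinearMap.range A ≠ ⊤ := fun h =>
      (LinearMap.range_lt_top_of_det_eq_zero h0).ne h
    have hae : ∀ᵐ b : Fin r → ℝ, μHE[m] {x ∈ D | ∀ i, inner ℝ (g i) x = b i} = 0 := by
      have hnull := Measure.addHaar_submodule (volume : Measure (Fin r → ℝ)) _ hrange
      rw [← compl_mem_ae_iff] at hnull
      filter_upwards [hnull] with b hb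
      convert measure_empty (μ := (μHE[m] : Measure (EuclideanSpace ℝ (Fin d))))
      ext x
      simp only [Set.mem_ofPred_eq, Set.mem_empty_iff_false, iff_false, not_and]
      rintro - hx
      refine hb ?_
      obtain ⟨⟨s, y⟩, rfl⟩ := (frameEquiv u).surjective x
      exact ⟨s, funext fun i => by rw [← hx i, inner_frameEquiv u g hg]⟩
    rw [lintegral_congr_ae hae]
    simp [h0]
  · have hslice : ∀ s : Fin r → ℝ, μHE[m] {x ∈ D | ∀ i, inner ℝ (g i) x = A s i} =
        volume {y | frameEquiv u (s, y) ∈ D} := by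
      intro s
      rw [← euclideanHausdorffMeasure_slice]
      congr 1
      ext x
      obtain ⟨⟨s', y⟩, rfl⟩ := (frameEquiv u).surjective x
      simp only [inner_frameEquiv u g hg, inner_frameEquiv_inl, Set.mem_ofPred_eq,
        and_congr_right_iff, ← hA]
      intro _
      constructor
      · intro h i
        exact congrFun ((LinearMap.equivOfDetNeZero A h0).injective (funext h)) i
      · intro h i
        rw [funext h]
    have hvol : (volume : Measure (Fin r → ℝ)) =
        ENNReal.ofReal |LinearMap.det A| • Measure.map A volume := by
      rw [Real.map_linearMap_volume_pi_eq_smul_volume_pi h0, smul_smul,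
        ← ENNReal.ofReal_mul (abs_nonneg _), ← abs_mul, mul_inv_cancel₀ h0]
      simp
    have hemb : MeasurableEmbedding A :=
      ((LinearMap.equivOfDetNeZero A h0).toContinuousLinearEquiv).toHomeomorph.measurableEmbedding
    calc ∫⁻ b : Fin r → ℝ, μHE[m] {x ∈ D | ∀ i, inner ℝ (g i) x = b i}
        = ENNReal.ofReal |LinearMap.det A| *
          ∫⁻ s : Fin r → ℝ, μHE[m] {x ∈ D | ∀ i, inner ℝ (g i) x = A s i} := by
          conv_lhs => rw [hvol]
          rw [lintegral_smul_measure, hemb.lintegral_map, smul_eq_mul]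
      _ = ENNReal.ofReal |LinearMap.det A| * volume D := by
          congr 1
          rw [← (measurePreserving_frameEquiv u).measure_preimage hD.nullMeasurableSet,
            Measure.volume_eq_prod, Measure.prod_apply ((frameEquiv u).measurable hD)]
          exact lintegral_congr hslice

end Frame

/-- Coarea inequality for the linear map with components `⟪g i, ·⟫`: its Jacobian is at most the
product of the norms of the `g i`, and each `g i` may be changed by a combination of the preceding
ones. -/
theorem lintegral_fiber_le {d r m : ℕ} (hd : r + m = d)
    (g v : Fin r → EuclideanSpace ℝ (Fin d))
    (hv : ∀ i, v i - g i ∈ Submodule.span ℝ (g '' Set.Iio i))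
    {D : Set (EuclideanSpace ℝ (Fin d))} (hD : MeasurableSet D) :
    ∫⁻ b : Fin r → ℝ, μHE[m] {x ∈ D | ∀ i, inner ℝ (g i) x = b i} ≤
      (∏ i, ‖v i‖ₑ) * volume D := by
  obtain ⟨u, hu1, hu2⟩ := exists_orthonormalBasis_triangular hd g
  rw [lintegral_fiber_eq u g hu2 hD]
  gcongr
  rw [det_frameMatrix u g hu1, Finset.abs_prod, ENNReal.ofReal_prod_of_nonneg
    (fun _ _ => abs_nonneg _)]
  refine Finset.prod_le_prod' fun i _ => ?_
  have hspan : inner ℝ (u (Sum.inl i)) (v i - g i) = 0 := by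
    refine Submodule.span_induction (p := fun w _ => inner ℝ (u (Sum.inl i)) w = 0) ?_ ?_ ?_ ?_
      (hv i)
    · rintro _ ⟨j, hj, rfl⟩
      exact hu1 j i hj
    · simp
    · intro x y _ _ hx hy
      rw [inner_add_right, hx, hy, add_zero]
    · intro a x _ hx
      rw [inner_smul_right, hx, mul_zero]
  have : inner ℝ (u (Sum.inl i)) (g i) = inner ℝ (u (Sum.inl i)) (v i) := by
    rw [inner_sub_right] at hspan
    linarith
  rw [this, ← ofReal_norm]
  refine ENNReal.ofReal_le_ofReal ((abs_real_inner_le_norm _ _).trans ?_)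
  simp

/-- The coarea inequality `lintegral_fiber_le` for affine functions `⟪g i, ·⟫ + c i` indexed by an
arbitrary finite type, graded by a function `level`. -/
theorem lintegral_affine_fiber_le {ι : Type*} [Fintype ι] {d m : ℕ}
    (hd : Fintype.card ι + m = d) (level : ι → ℕ) (g v : ι → EuclideanSpace ℝ (Fin d))
    (hv : ∀ i, v i - g i ∈ Submodule.span ℝ (g '' {j | level j < level i})) (c : ι → ℝ)
    {D : Set (EuclideanSpace ℝ (Fin d))} (hD : MeasurableSet D) :
    ∫⁻ b : ι → ℝ, μHE[m] {x ∈ D | ∀ i, inner ℝ (g i) x + c i + b i = 0} ≤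
      (∏ i, ‖v i‖ₑ) * volume D := by
  let e₀ : Fin (Fintype.card ι) ≃ ι := (Fintype.equivFin ι).symm
  let e : Fin (Fintype.card ι) ≃ ι := (Tuple.sort (level ∘ e₀)).trans e₀
  have hmono : Monotone (level ∘ e) := Tuple.monotone_sort (level ∘ e₀)
  have hv' : ∀ i, (v ∘ e) i - (g ∘ e) i ∈ Submodule.span ℝ ((g ∘ e) '' Set.Iio i) := by
    intro i
    refine Submodule.span_mono ?_ (hv (e i))
    rintro _ ⟨j, hj, rfl⟩
    refine ⟨e.symm j, ?_, by simp⟩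
    by_contra hij
    have := hmono (not_lt.1 hij)
    simp only [Function.comp_apply, Equiv.apply_symm_apply] at this
    exact absurd hj (not_lt.2 this)
  calc ∫⁻ b : ι → ℝ, μHE[m] {x ∈ D | ∀ i, inner ℝ (g i) x + c i + b i = 0}
      = ∫⁻ b : ι → ℝ, μHE[m] {x ∈ D | ∀ i, inner ℝ (g i) x = b i} := by
        rw [← lintegral_sub_left_eq_self
          (fun b : ι → ℝ => μHE[m] {x ∈ D | ∀ i, inner ℝ (g i) x = b i}) (-c)]
        refine lintegral_congr fun b => ?_
        congr 1
        ext x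
        refine and_congr_right fun _ => forall_congr' fun i => ?_
        simp only [Pi.sub_apply, Pi.neg_apply]
        constructor <;> intro h <;> linarith
    _ = ∫⁻ b : Fin (Fintype.card ι) → ℝ, μHE[m] {x ∈ D | ∀ i, inner ℝ ((g ∘ e) i) x = b i} := by
        rw [← (volume_measurePreserving_piCongrLeft (fun _ : ι => ℝ) e).lintegral_comp_emb
          (MeasurableEquiv.measurableEmbedding _)]
        refine lintegral_congr fun b => ?_
        congr 1
        ext x
        refine and_congr_right fun _ => ?_
        rw [← e.forall_congr_right]
        refine forall_congr' fun i => ?_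
        rw [MeasurableEquiv.coe_piCongrLeft, Equiv.piCongrLeft_apply_apply, Function.comp_apply]
    _ ≤ (∏ i, ‖(v ∘ e) i‖ₑ) * volume D := lintegral_fiber_le hd _ _ hv' hD
    _ = (∏ i, ‖v i‖ₑ) * volume D := by
        rw [← e.prod_comp]
        rfl

/-! ### Measurability of the volume of affine sections -/

section Projection

variable {ι : Type*} [Fintype ι] [DecidableEq ι] {d : ℕ}

/-- The orthogonal projection of `x` onto the affine subspace `{x | ∀ i, ⟪g i, x⟫ = y i}`, given by
the Gram matrix of the normal vectors `g i` (which has to be invertible). -/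
def affineProj (g : ι → EuclideanSpace ℝ (Fin d)) (y : ι → ℝ) (x : EuclideanSpace ℝ (Fin d)) :
    EuclideanSpace ℝ (Fin d) :=
  x - ∑ i, ((Matrix.gram ℝ g)⁻¹.mulVec fun k => inner ℝ (g k) x - y k) i • g i

omit [Fintype ι] [DecidableEq ι] in
lemma continuous_gram :
    Continuous fun g : ι → EuclideanSpace ℝ (Fin d) => Matrix.gram ℝ g := by
  refine continuous_matrix fun i j => ?_
  simp only [Matrix.gram_apply]
  fun_prop

lemma continuous_det_gram :
    Continuous fun g : ι → EuclideanSpace ℝ (Fin d) => (Matrix.gram ℝ g).det :=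
  continuous_gram.matrix_det

lemma measurable_affineProj :
    Measurable fun p : (ι → EuclideanSpace ℝ (Fin d)) × (ι → ℝ) × EuclideanSpace ℝ (Fin d) =>
      affineProj p.1 p.2.1 p.2.2 := by
  have hinv : ∀ i k, Measurable fun g : ι → EuclideanSpace ℝ (Fin d) =>
      (Matrix.gram ℝ g)⁻¹ i k := by
    intro i k
    have hadj : Continuous fun g : ι → EuclideanSpace ℝ (Fin d) =>
        (Matrix.gram ℝ g).adjugate i k :=
      (continuous_gram.matrix_adjugate).matrix_elem i k
    simp only [Matrix.inv_def, Matrix.smul_apply, smul_eq_mul, Ring.inverse_eq_inv']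
    exact continuous_det_gram.measurable.inv.mul hadj.measurable
  have hg : ∀ k, Measurable fun p : (ι → EuclideanSpace ℝ (Fin d)) × (ι → ℝ) ×
      EuclideanSpace ℝ (Fin d) => p.1 k := fun k => by fun_prop
  have hw : ∀ i, Measurable fun p : (ι → EuclideanSpace ℝ (Fin d)) × (ι → ℝ) ×
      EuclideanSpace ℝ (Fin d) =>
      (Matrix.gram ℝ p.1)⁻¹.mulVec (fun k => inner ℝ (p.1 k) p.2.2 - p.2.1 k) i := by
    intro i
    unfold Matrix.mulVec dotProduct
    refine Finset.measurable_sum _ fun k _ => ((hinv i k).comp measurable_fst).mul ?_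
    refine Measurable.sub ((hg k).inner (measurable_snd.comp measurable_snd)) ?_
    fun_prop
  exact (measurable_snd.comp measurable_snd).sub
    (Finset.measurable_sum _ fun i _ => (hw i).smul (hg i))

end Projection

section Thickening

variable {d r m : ℕ} (u : OrthonormalBasis (Fin r ⊕ Fin m) ℝ (EuclideanSpace ℝ (Fin d)))
  (g : Fin r → EuclideanSpace ℝ (Fin d))

lemma gram_eq_frameMatrix_mul (hg : ∀ i j, inner ℝ (u (Sum.inr j)) (g i) = 0) :
    Matrix.gram ℝ g = frameMatrix u g * (frameMatrix u g).transpose := by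
  ext i k
  rw [Matrix.gram_apply, ← u.sum_inner_mul_inner, Fintype.sum_sum_type]
  simp [hg, Matrix.mul_apply, frameMatrix, real_inner_comm]

lemma affineProj_frameEquiv (hg : ∀ i j, inner ℝ (u (Sum.inr j)) (g i) = 0)
    (hdet : (Matrix.gram ℝ g).det ≠ 0) (s₀ : Fin r → ℝ) (s : Fin r → ℝ) (y : Fin m → ℝ) :
    affineProj g (Matrix.toLin' (frameMatrix u g) s₀) (frameEquiv u (s, y)) =
      frameEquiv u (s₀, y) := by
  set A := frameMatrix u g
  have hAdet : A.det ≠ 0 := fun h => hdet (by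
    rw [gram_eq_frameMatrix_mul u g hg, Matrix.det_mul, h, zero_mul])
  have hexp : ∀ i, g i = ∑ j, A i j • u (Sum.inl j) := by
    intro i
    conv_lhs => rw [← u.sum_repr' (g i)]
    simp [Fintype.sum_sum_type, hg, A, frameMatrix]
  have hcomb : ∀ w : Fin r → ℝ, ∑ i, w i • g i = ∑ j, (A.transpose.mulVec w) j • u (Sum.inl j) := by
    intro w
    simp_rw [hexp, Finset.smul_sum, smul_smul]
    rw [Finset.sum_comm]
    refine Finset.sum_congr rfl fun j _ => ?_
    rw [← Finset.sum_smul]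
    congr 1
    simp [Matrix.mulVec, dotProduct, mul_comm]
  have hw : A.transpose.mulVec ((Matrix.gram ℝ g)⁻¹.mulVec
      fun k => inner ℝ (g k) (frameEquiv u (s, y)) - Matrix.toLin' A s₀ k) = s - s₀ := by
    have h1 : (fun k => inner ℝ (g k) (frameEquiv u (s, y)) - Matrix.toLin' A s₀ k) =
        A.mulVec (s - s₀) := by
      ext k
      rw [inner_frameEquiv u g hg, Matrix.mulVec_sub]
      simp [A]
    have hu : IsUnit A.det := isUnit_iff_ne_zero.2 hAdet
    have hut : IsUnit A.transpose.det := by rwa [Matrix.det_transpose]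
    have hprod : A.transpose * ((A * A.transpose)⁻¹ * A) = 1 := by
      rw [Matrix.mul_inv_rev, Matrix.mul_assoc, Matrix.nonsing_inv_mul _ hu, Matrix.mul_one,
        Matrix.mul_nonsing_inv _ hut]
    rw [h1, Matrix.mulVec_mulVec, Matrix.mulVec_mulVec, gram_eq_frameMatrix_mul u g hg,
      Matrix.mul_assoc, hprod, Matrix.one_mulVec]
  rw [affineProj, hcomb, hw]
  rw [frameEquiv_apply, frameEquiv_apply]
  simp only [Pi.sub_apply, sub_smul, Finset.sum_sub_distrib]
  abel

/-- The volume of an `r`-dimensional Euclidean unit ball. -/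
def ballVolume (r : ℕ) : ENNReal :=
  volume (Metric.ball (0 : EuclideanSpace ℝ (Fin r)) 1)

/-- A set in an affine subspace, thickened by a unit ball in the orthogonal directions, has the
volume of the set times the volume of the ball. -/
lemma volume_thickening (hg : ∀ i j, inner ℝ (u (Sum.inr j)) (g i) = 0)
    (hdet : (Matrix.gram ℝ g).det ≠ 0) (y : Fin r → ℝ) (Z : Set (EuclideanSpace ℝ (Fin d))) :
    volume {x | ‖x - affineProj g y x‖ < 1 ∧ affineProj g y x ∈ Z} =
      ballVolume r * μHE[m] {x ∈ Z | ∀ i, inner ℝ (g i) x = y i} := by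
  have hAdet : (frameMatrix u g).det ≠ 0 := fun h => hdet (by
    rw [gram_eq_frameMatrix_mul u g hg, Matrix.det_mul, h, zero_mul])
  have hLdet : LinearMap.det (Matrix.toLin' (frameMatrix u g)) ≠ 0 := by
    rwa [LinearMap.det_toLin']
  obtain ⟨s₀, rfl⟩ := (LinearMap.equivOfDetNeZero _ hLdet).surjective y
  change volume {x | ‖x - affineProj g (Matrix.toLin' (frameMatrix u g) s₀) x‖ < 1 ∧
      affineProj g (Matrix.toLin' (frameMatrix u g) s₀) x ∈ Z} =
    ballVolume r * μHE[m] {x ∈ Z | ∀ i, inner ℝ (g i) x =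
      Matrix.toLin' (frameMatrix u g) s₀ i}
  have hset : {x ∈ Z | ∀ i, inner ℝ (g i) x = Matrix.toLin' (frameMatrix u g) s₀ i} =
      {x ∈ Z | ∀ i, inner ℝ (u (Sum.inl i)) x = s₀ i} := by
    ext x
    obtain ⟨⟨s', y⟩, rfl⟩ := (frameEquiv u).surjective x
    simp only [inner_frameEquiv u g hg, inner_frameEquiv_inl, Set.mem_ofPred_eq,
      and_congr_right_iff]
    intro _
    constructor
    · intro h i
      exact congrFun ((LinearMap.equivOfDetNeZero _ hLdet).injective (funext h)) i
    · intro h i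
      rw [funext h]
  have hpre : frameEquiv u ⁻¹' {x | ‖x - affineProj g (Matrix.toLin' (frameMatrix u g) s₀) x‖ < 1 ∧
      affineProj g (Matrix.toLin' (frameMatrix u g) s₀) x ∈ Z} =
      ((fun s => s - s₀) ⁻¹' (WithLp.toLp 2 ⁻¹' Metric.ball (0 : EuclideanSpace ℝ (Fin r)) 1)) ×ˢ
        {y | frameEquiv u (s₀, y) ∈ Z} := by
    ext ⟨s, y⟩
    have hnorm : ‖frameEquiv u (s, y) - frameEquiv u (s₀, y)‖ =
        ‖(WithLp.toLp 2 (s - s₀) : EuclideanSpace ℝ (Fin r))‖ := by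
      have h1 : frameEquiv u (s, y) - frameEquiv u (s₀, y) = frameEquiv u (s - s₀, 0) := by
        simp [frameEquiv_apply, sub_smul, Finset.sum_sub_distrib]
      have h2 : frameEquiv u (s - s₀, 0)
          = u.repr.symm (WithLp.toLp 2 (Sum.elim (s - s₀) 0)) := rfl
      rw [h1, h2, LinearIsometryEquiv.norm_map, EuclideanSpace.norm_eq, EuclideanSpace.norm_eq,
        Fintype.sum_sum_type]
      simp
    simp only [Set.mem_preimage, Set.mem_ofPred_eq, affineProj_frameEquiv u g hg hdet, hnorm,
      Set.mem_prod, mem_ball_zero_iff]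
  rw [hset, euclideanHausdorffMeasure_slice,
    ← (measurePreserving_frameEquiv u).measure_preimage_equiv, hpre, Measure.volume_eq_prod,
    Measure.prod_prod]
  congr 1
  refine ((measurePreserving_sub_right volume s₀).measure_preimage_equiv
    (f := MeasurableEquiv.subRight s₀) _).trans ?_
  exact (PiLp.volume_preserving_toLp (Fin r)).measure_preimage_equiv
    (f := MeasurableEquiv.toLp 2 (Fin r → ℝ)) _

end Thickening

section Measurability

variable {ι : Type*} [Fintype ι] [DecidableEq ι] {d m : ℕ}

/-- The volume of the sections of a measurable set by affine subspaces of the expected dimension is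
a measurable function of the parameters. -/
theorem measurable_section_volume {Θ : Type*} [MeasurableSpace Θ] (hd : Fintype.card ι + m = d)
    {g : Θ → ι → EuclideanSpace ℝ (Fin d)} (hg : Measurable g) {y : Θ → ι → ℝ} (hy : Measurable y)
    {Z : Set (Θ × EuclideanSpace ℝ (Fin d))} (hZ : MeasurableSet Z) :
    Measurable ({θ | (Matrix.gram ℝ (g θ)).det ≠ 0}.indicator fun θ =>
      μHE[m] {x | (θ, x) ∈ Z ∧ ∀ i, inner ℝ (g θ i) x = y θ i}) := by
  have hdet : MeasurableSet {θ | (Matrix.gram ℝ (g θ)).det ≠ 0} :=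
    (continuous_det_gram.measurable.comp hg) (measurableSet_singleton 0).compl
  have hproj : Measurable fun p : Θ × EuclideanSpace ℝ (Fin d) => affineProj (g p.1) (y p.1) p.2 :=
    measurable_affineProj.comp
      ((hg.comp measurable_fst).prodMk ((hy.comp measurable_fst).prodMk measurable_snd))
  have hset : MeasurableSet {p : Θ × EuclideanSpace ℝ (Fin d) |
      ‖p.2 - affineProj (g p.1) (y p.1) p.2‖ < 1 ∧ (p.1, affineProj (g p.1) (y p.1) p.2) ∈ Z} :=
    (measurableSet_lt (measurable_snd.sub hproj).norm measurable_const).inter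
      ((measurable_fst.prodMk hproj) hZ)
  have hball0 : ballVolume (Fintype.card ι) ≠ 0 := (Metric.measure_ball_pos _ _ one_pos).ne'
  have hballtop : ballVolume (Fintype.card ι) ≠ ⊤ := measure_ball_lt_top.ne
  let e := (Fintype.equivFin ι).symm
  have key : ({θ | (Matrix.gram ℝ (g θ)).det ≠ 0}.indicator fun θ =>
      μHE[m] {x | (θ, x) ∈ Z ∧ ∀ i, inner ℝ (g θ i) x = y θ i}) =
      {θ | (Matrix.gram ℝ (g θ)).det ≠ 0}.indicator fun θ =>
        (ballVolume (Fintype.card ι))⁻¹ * volume (Prod.mk θ ⁻¹' {p : Θ × EuclideanSpace ℝ (Fin d) |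
          ‖p.2 - affineProj (g p.1) (y p.1) p.2‖ < 1 ∧
            (p.1, affineProj (g p.1) (y p.1) p.2) ∈ Z}) := by
    refine Set.indicator_congr fun θ hθ => ?_
    have hgram : Matrix.gram ℝ (g θ ∘ e) = (Matrix.gram ℝ (g θ)).submatrix e e := rfl
    have hdet' : (Matrix.gram ℝ (g θ ∘ e)).det ≠ 0 := by
      rwa [hgram, Matrix.det_submatrix_equiv_self]
    have hproj' : ∀ x, affineProj (g θ ∘ e) (y θ ∘ e) x = affineProj (g θ) (y θ) x := by
      intro x
      rw [affineProj, affineProj, hgram, Matrix.inv_submatrix_equiv, ← e.sum_comp]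
      refine congrArg _ (Finset.sum_congr rfl fun i _ => ?_)
      congr 1
      rw [Matrix.mulVec, Matrix.mulVec, dotProduct, dotProduct, ← e.sum_comp]
      rfl
    obtain ⟨u, -, hu⟩ := exists_orthonormalBasis_triangular hd (g θ ∘ e)
    have := volume_thickening u (g θ ∘ e) hu hdet' (y θ ∘ e) (Prod.mk θ ⁻¹' Z)
    simp only [hproj'] at this
    have hS : {x | (θ, x) ∈ Z ∧ ∀ i, inner ℝ (g θ i) x = y θ i} =
        {x ∈ Prod.mk θ ⁻¹' Z | ∀ i, inner ℝ ((g θ ∘ e) i) x = (y θ ∘ e) i} := by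
      ext x
      refine and_congr_right fun _ => ?_
      rw [← e.forall_congr_right]
      rfl
    rw [hS]
    rw [← ENNReal.inv_mul_cancel_left hball0 hballtop (b := μHE[m] _), ← this]
    rfl
  rw [key]
  exact ((measurable_measure_prodMk_left hset).const_mul _).indicator hdet

/-- For linearly dependent normal vectors, almost all affine subspaces are empty. -/
lemma ae_section_empty {O : Type*} [MeasurableSpace O] (μ : Measure O) [SFinite μ]
    {g : O → ι → EuclideanSpace ℝ (Fin d)} (hg : Measurable g) {c : O → ι → ℝ} (hc : Measurable c) :
    ∀ᵐ p : O × (ι → ℝ) ∂(μ.prod volume), (Matrix.gram ℝ (g p.1)).det = 0 →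
      ∀ x, ¬ ∀ i, inner ℝ (g p.1 i) x = -c p.1 i - p.2 i := by
  let L : (ι → EuclideanSpace ℝ (Fin d)) → EuclideanSpace ℝ (Fin d) →ₗ[ℝ] (ι → ℝ) := fun v =>
    LinearMap.pi fun i => (innerₛₗ ℝ (v i))
  have hL : ∀ v x i, L v x i = inner ℝ (v i) x := fun v x i => rfl
  -- membership in the range of `L` is a countable condition
  let q := TopologicalSpace.denseSeq (EuclideanSpace ℝ (Fin d))
  have hrange : ∀ v w, (∃ x, L v x = w) ↔ ∀ n : ℕ, ∃ k, ‖L v (q k) - w‖ < 1 / ((n : ℝ) + 1) := by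
    intro v w
    have hLc : Continuous (L v) := (L v).continuous_of_finiteDimensional
    constructor
    · rintro ⟨x, rfl⟩ n
      have hopen : IsOpen {z | ‖L v z - L v x‖ < 1 / ((n : ℝ) + 1)} :=
        isOpen_lt (by fun_prop) continuous_const
      obtain ⟨_, hz, k, rfl⟩ := (TopologicalSpace.denseRange_denseSeq _).inter_open_nonempty _ hopen
        ⟨x, by simp; positivity⟩
      exact ⟨k, hz⟩
    · intro h
      have hcl : IsClosed (LinearMap.range (L v) : Set (ι → ℝ)) :=
        Submodule.closed_of_finiteDimensional _
      have : w ∈ closure (LinearMap.range (L v) : Set (ι → ℝ)) := by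
        rw [Metric.mem_closure_iff]
        intro ε hε
        obtain ⟨n, hn⟩ := exists_nat_one_div_lt hε
        obtain ⟨k, hk⟩ := h n
        refine ⟨L v (q k), ⟨_, rfl⟩, ?_⟩
        rw [dist_comm, dist_eq_norm]
        exact hk.trans hn
      rw [hcl.closure_eq] at this
      exact this
  have hmeas : MeasurableSet {p : O × (ι → ℝ) | (Matrix.gram ℝ (g p.1)).det = 0 ∧
      ∃ x, L (g p.1) x = -c p.1 - p.2} := by
    have hset : {p : O × (ι → ℝ) | (Matrix.gram ℝ (g p.1)).det = 0 ∧
        ∃ x, L (g p.1) x = -c p.1 - p.2} = {p : O × (ι → ℝ) | (Matrix.gram ℝ (g p.1)).det = 0 ∧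
        ∀ n : ℕ, ∃ k, ‖L (g p.1) (q k) - (-c p.1 - p.2)‖ < 1 / ((n : ℝ) + 1)} := by
      ext p
      exact and_congr_right fun _ => hrange _ _
    rw [hset]
    refine MeasurableSet.inter ((continuous_det_gram.measurable.comp (hg.comp measurable_fst))
      (measurableSet_singleton 0)) ?_
    change MeasurableSet {p : O × (ι → ℝ) |
      ∀ n : ℕ, ∃ k, ‖L (g p.1) (q k) - (-c p.1 - p.2)‖ < 1 / ((n : ℝ) + 1)}
    simp only [Set.ofPred_forall, Set.ofPred_exists]
    refine MeasurableSet.iInter fun n => MeasurableSet.iUnion fun k => ?_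
    refine measurableSet_lt (Measurable.norm (Measurable.sub ?_ ?_)) measurable_const
    · refine measurable_pi_iff.2 fun i => ?_
      simp only [hL]
      exact (((measurable_pi_apply i).comp hg).comp measurable_fst).inner measurable_const
    · exact ((hc.comp measurable_fst).neg).sub measurable_snd
  have hnull : (μ.prod volume) {p : O × (ι → ℝ) | (Matrix.gram ℝ (g p.1)).det = 0 ∧
      ∃ x, L (g p.1) x = -c p.1 - p.2} = 0 := by
    rw [Measure.measure_prod_null hmeas]
    refine Filter.Eventually.of_forall fun o => ?_
    by_cases hdet : (Matrix.gram ℝ (g o)).det = 0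
    · have hne : LinearMap.range (L (g o)) ≠ ⊤ := by
        intro htop
        obtain ⟨w, hw0, hw⟩ := Matrix.exists_mulVec_eq_zero_iff.2 hdet
        -- a vector in the kernel of the Gram matrix is orthogonal to the range
        have hsum : ∑ i, w i • g o i = 0 := by
          rw [← inner_self_eq_zero (𝕜 := ℝ), sum_inner]
          refine Finset.sum_eq_zero fun i _ => ?_
          rw [inner_smul_left, inner_sum]
          have := congrFun hw i
          simp only [Matrix.mulVec, dotProduct, Matrix.gram_apply, Pi.zero_apply] at this
          simp only [inner_smul_right]
          rw [show ∑ j, w j * inner ℝ (g o i) (g o j) = 0 by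
            rw [← this]; exact Finset.sum_congr rfl fun j _ => mul_comm _ _, mul_zero]
        obtain ⟨x, hx⟩ := LinearMap.range_eq_top.1 htop w
        have : ∑ i, w i * w i = 0 := by
          have h0 : inner ℝ (∑ i, w i • g o i) x = 0 := by rw [hsum, inner_zero_left]
          rw [sum_inner] at h0
          rw [← h0]
          refine Finset.sum_congr rfl fun i _ => ?_
          rw [inner_smul_left, ← hL, hx]
          rfl
        refine hw0 (funext fun i => ?_)
        have := (Finset.sum_eq_zero_iff_of_nonneg fun j _ => mul_self_nonneg (w j)).1 this i
          (Finset.mem_univ i)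
        simpa using this
      have h0 := Measure.addHaar_submodule (volume : Measure (ι → ℝ)) _ hne
      have hpre : Prod.mk o ⁻¹' {p : O × (ι → ℝ) | (Matrix.gram ℝ (g p.1)).det = 0 ∧
          ∃ x, L (g p.1) x = -c p.1 - p.2} =
          (fun b => -c o - b) ⁻¹' (LinearMap.range (L (g o)) : Set (ι → ℝ)) := by
        ext b
        simp [hdet]
      change volume (Prod.mk o ⁻¹' _) = 0
      rw [hpre]
      exact ((volume.measurePreserving_sub_left (-c o)).quasiMeasurePreserving).preimage_null h0
    · simp [hdet]
  rw [← compl_mem_ae_iff] at hnull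
  filter_upwards [hnull] with p hp hdet x hx
  exact hp ⟨hdet, x, funext hx⟩

/-- The volume of the sections of a measurable set by the affine subspaces
`{x | ∀ i, ⟪g o i, x⟫ + c o i + b i = 0}` is almost everywhere measurable in `(o, b)`. -/
theorem aemeasurable_section_volume {O : Type*} [MeasurableSpace O] (μ : Measure O) [SFinite μ]
    (hd : Fintype.card ι + m = d)
    {g : O → ι → EuclideanSpace ℝ (Fin d)} (hg : Measurable g) {c : O → ι → ℝ} (hc : Measurable c)
    {Z : Set ((O × (ι → ℝ)) × EuclideanSpace ℝ (Fin d))} (hZ : MeasurableSet Z) :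
    AEMeasurable (fun p : O × (ι → ℝ) =>
      μHE[m] {x | (p, x) ∈ Z ∧ ∀ i, inner ℝ (g p.1 i) x + c p.1 i + p.2 i = 0})
      (μ.prod volume) := by
  have hset : ∀ p : O × (ι → ℝ),
      {x | (p, x) ∈ Z ∧ ∀ i, inner ℝ (g p.1 i) x + c p.1 i + p.2 i = 0} =
      {x | (p, x) ∈ Z ∧ ∀ i, inner ℝ (g p.1 i) x = -c p.1 i - p.2 i} := by
    intro p
    ext x
    refine and_congr_right fun _ => forall_congr' fun i => ?_
    constructor <;> intro h <;> linarith
  simp only [hset]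
  refine ⟨_, measurable_section_volume (m := m) hd (hg.comp measurable_fst)
    (y := fun p : O × (ι → ℝ) => -c p.1 - p.2)
    (((hc.comp measurable_fst).neg).sub measurable_snd) hZ, ?_⟩
  filter_upwards [ae_section_empty μ hg hc] with p hp
  by_cases hdet : (Matrix.gram ℝ (g p.1)).det = 0
  · rw [Set.indicator_of_notMem (by simpa using hdet)]
    convert measure_empty (μ := (μHE[m] : Measure (EuclideanSpace ℝ (Fin d))))
    ext x
    simp only [Set.mem_ofPred_eq, Set.mem_empty_iff_false, iff_false, not_and]
    exact fun _ => hp hdet x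
  · rw [Set.indicator_of_mem (by simpa using hdet)]
    rfl

end Measurability

/-! ### Affine pieces of maxout networks -/

section Network

variable {L K : ℕ} {n : Fin (L + 1) → ℕ}

lemma activation_succ (θ : Params n K) (x : EuclideanSpace ℝ (Fin (n 0))) (l : Fin L)
    (i : Fin (n l.succ)) : activation θ x l.succ i = ⨆ k, feature θ ⟨l, i⟩ k x := rfl

lemma continuous_affineFeature {X : Type*} [TopologicalSpace X] {θ : X → Params n K} {l : Fin L}
    {a : X → Fin (n l.castSucc) → ℝ} (hθ : Continuous θ) (ha : Continuous a) (i : Fin (n l.succ))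
    (k : Fin K) : Continuous fun p => affineFeature (θ p) l (a p) i k := by
  unfold affineFeature
  fun_prop

lemma continuous_activation (l : Fin (L + 1)) :
    Continuous fun p : Params n K × EuclideanSpace ℝ (Fin (n 0)) => activation p.1 p.2 l := by
  induction l using Fin.induction with
  | zero =>
    change Continuous fun p : Params n K × EuclideanSpace ℝ (Fin (n 0)) => fun i => p.2 i
    fun_prop
  | succ l ih =>
    refine continuous_pi fun i => ?_
    simp only [activation_succ]
    rcases isEmpty_or_nonempty (Fin K) with hK | hK
    · simp only [iSup_of_empty']
      exact continuous_const
    · simp only [← Finset.sup'_univ_eq_ciSup]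
      exact Continuous.finset_sup'_apply _ fun k _ => continuous_affineFeature continuous_fst ih i k

lemma continuous_feature (z : HiddenUnit n) (k : Fin K) :
    Continuous fun p : Params n K × EuclideanSpace ℝ (Fin (n 0)) => feature p.1 z k p.2 :=
  continuous_affineFeature continuous_fst (continuous_activation _) _ _

/-- The activation values of layer `l` when every unit `z` outputs its affine feature with index
`sel z` instead of the maximum of its features. -/
def selActivation (θ : Params n K) (sel : HiddenUnit n → Fin K)
    (x : EuclideanSpace ℝ (Fin (n 0))) (l : Fin (L + 1)) : Fin (n l) → ℝ :=
  Fin.induction (motive := fun l => Fin (n l) → ℝ) (fun i => x i)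
    (fun l a i => affineFeature θ l a i (sel ⟨l, i⟩)) l

/-- The pre-activation features of the affine network in which every unit `z` outputs its feature
with index `sel z`. -/
def selFeature (θ : Params n K) (sel : HiddenUnit n → Fin K) (z : HiddenUnit n) (k : Fin K)
    (x : EuclideanSpace ℝ (Fin (n 0))) : ℝ :=
  affineFeature θ z.1 (selActivation θ sel x z.1.castSucc) z.2 k

lemma selActivation_succ (θ : Params n K) (sel : HiddenUnit n → Fin K)
    (x : EuclideanSpace ℝ (Fin (n 0))) (l : Fin L) (i : Fin (n l.succ)) :
    selActivation θ sel x l.succ i = selFeature θ sel ⟨l, i⟩ (sel ⟨l, i⟩) x := rfl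

lemma continuous_selActivation (sel : HiddenUnit n → Fin K) (l : Fin (L + 1)) :
    Continuous fun p : Params n K × EuclideanSpace ℝ (Fin (n 0)) =>
      selActivation p.1 sel p.2 l := by
  induction l using Fin.induction with
  | zero =>
    change Continuous fun p : Params n K × EuclideanSpace ℝ (Fin (n 0)) => fun i => p.2 i
    fun_prop
  | succ l ih =>
    exact continuous_pi fun i => continuous_affineFeature continuous_fst ih i _

lemma continuous_selFeature (sel : HiddenUnit n → Fin K) (z : HiddenUnit n) (k : Fin K) :
    Continuous fun p : Params n K × EuclideanSpace ℝ (Fin (n 0)) => selFeature p.1 sel z k p.2 :=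
  continuous_affineFeature continuous_fst (continuous_selActivation sel _) _ _

/-- The gradients of the activation values `selActivation θ sel · l`; they depend on the weights
only. -/
def selActivationGrad (w : WeightIndex n K → ℝ) (sel : HiddenUnit n → Fin K) (l : Fin (L + 1)) :
    Fin (n l) → EuclideanSpace ℝ (Fin (n 0)) :=
  Fin.induction (motive := fun l => Fin (n l) → EuclideanSpace ℝ (Fin (n 0)))
    (fun i => EuclideanSpace.single i 1)
    (fun l a i => ∑ j, w ⟨l, i, sel ⟨l, i⟩, j⟩ • a j) l

/-- The gradient of the feature `selFeature θ sel z k`. -/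
def selGrad (w : WeightIndex n K → ℝ) (sel : HiddenUnit n → Fin K) (z : HiddenUnit n)
    (k : Fin K) : EuclideanSpace ℝ (Fin (n 0)) :=
  ∑ j, w ⟨z.1, z.2, k, j⟩ • selActivationGrad w sel z.1.castSucc j

lemma selActivationGrad_succ (w : WeightIndex n K → ℝ) (sel : HiddenUnit n → Fin K) (l : Fin L)
    (i : Fin (n l.succ)) :
    selActivationGrad w sel l.succ i = selGrad w sel ⟨l, i⟩ (sel ⟨l, i⟩) := rfl

lemma continuous_selActivationGrad (sel : HiddenUnit n → Fin K) (l : Fin (L + 1)) :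
    Continuous fun w : WeightIndex n K → ℝ => selActivationGrad w sel l := by
  induction l using Fin.induction with
  | zero => exact continuous_const
  | succ l ih =>
    refine continuous_pi fun i => ?_
    simp only [selActivationGrad_succ, selGrad]
    fun_prop

lemma continuous_selGrad (sel : HiddenUnit n → Fin K) (z : HiddenUnit n) (k : Fin K) :
    Continuous fun w : WeightIndex n K → ℝ => selGrad w sel z k := by
  have := continuous_selActivationGrad (n := n) sel z.1.castSucc
  unfold selGrad
  fun_prop

lemma affineFeature_inner (θ : Params n K) (l : Fin L)
    (v : Fin (n l.castSucc) → EuclideanSpace ℝ (Fin (n 0))) (a : Fin (n l.castSucc) → ℝ)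
    (x : EuclideanSpace ℝ (Fin (n 0))) (i : Fin (n l.succ)) (k : Fin K) :
    affineFeature θ l (fun j => inner ℝ (v j) x + a j) i k =
      inner ℝ (∑ j, θ.1 ⟨l, i, k, j⟩ • v j) x + affineFeature θ l a i k := by
  simp only [affineFeature, sum_inner, inner_smul_left, mul_add, Finset.sum_add_distrib]
  simp [add_assoc]

lemma selActivation_eq_inner_add (θ : Params n K) (sel : HiddenUnit n → Fin K)
    (x : EuclideanSpace ℝ (Fin (n 0))) (l : Fin (L + 1)) :
    selActivation θ sel x l =
      fun i => inner ℝ (selActivationGrad θ.1 sel l i) x + selActivation θ sel 0 l i := by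
  induction l using Fin.induction with
  | zero =>
    funext i
    change x i = inner ℝ (EuclideanSpace.single i (1 : ℝ)) x + 0
    rw [EuclideanSpace.inner_single_left]
    simp
  | succ l ih =>
    funext i
    rw [selActivation_succ, selFeature, ih, affineFeature_inner]
    rfl

lemma selFeature_eq_inner_add (θ : Params n K) (sel : HiddenUnit n → Fin K) (z : HiddenUnit n)
    (k : Fin K) (x : EuclideanSpace ℝ (Fin (n 0))) :
    selFeature θ sel z k x = inner ℝ (selGrad θ.1 sel z k) x + selFeature θ sel z k 0 := by
  rw [selFeature, selActivation_eq_inner_add, affineFeature_inner]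
  rfl

lemma hasGradientAt_selFeature (θ : Params n K) (sel : HiddenUnit n → Fin K) (z : HiddenUnit n)
    (k : Fin K) (x : EuclideanSpace ℝ (Fin (n 0))) :
    HasGradientAt (selFeature θ sel z k) (selGrad θ.1 sel z k) x := by
  rw [hasGradientAt_iff_hasFDerivAt]
  have h : selFeature θ sel z k = fun x => (InnerProductSpace.toDual ℝ
      (EuclideanSpace ℝ (Fin (n 0))) (selGrad θ.1 sel z k)) x + selFeature θ sel z k 0 := by
    funext x
    rw [selFeature_eq_inner_add, InnerProductSpace.toDual_apply_apply]
  rw [h]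
  exact (ContinuousLinearMap.hasFDerivAt _).add_const _

/-- The inputs at which the unit outputs of the affine network given by `sel` agree with the
maxima of its features. -/
def cell (θ : Params n K) (sel : HiddenUnit n → Fin K) : Set (EuclideanSpace ℝ (Fin (n 0))) :=
  {x | ∀ z k, selFeature θ sel z k x ≤ selFeature θ sel z (sel z) x}

lemma isClosed_cell (θ : Params n K) (sel : HiddenUnit n → Fin K) : IsClosed (cell θ sel) := by
  have h : ∀ z k, Continuous (selFeature θ sel z k) := fun z k =>
    (continuous_selFeature sel z k).comp (by fun_prop : Continuous fun x => (θ, x))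
  simp only [cell, Set.ofPred_forall]
  exact isClosed_iInter fun z => isClosed_iInter fun k => isClosed_le (h z k) (h z _)

lemma convex_cell (θ : Params n K) (sel : HiddenUnit n → Fin K) : Convex ℝ (cell θ sel) := by
  intro x hx y hy a b ha hb hab z k
  have hcomb : ∀ k, selFeature θ sel z k (a • x + b • y) =
      a * selFeature θ sel z k x + b * selFeature θ sel z k y := by
    intro k
    rw [selFeature_eq_inner_add, selFeature_eq_inner_add θ sel z k x,
      selFeature_eq_inner_add θ sel z k y, inner_add_right, inner_smul_right, inner_smul_right]
    linear_combination (-selFeature θ sel z k 0) * hab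
  rw [hcomb, hcomb]
  exact add_le_add (mul_le_mul_of_nonneg_left (hx z k) ha) (mul_le_mul_of_nonneg_left (hy z k) hb)

lemma ciSup_eq_of_forall_le {f : Fin K → ℝ} {k : Fin K} (h : ∀ j, f j ≤ f k) :
    ⨆ j, f j = f k :=
  haveI : Nonempty (Fin K) := ⟨k⟩
  le_antisymm (ciSup_le h) (le_ciSup (Set.finite_range f).bddAbove k)

lemma activation_eq_selActivation {θ : Params n K} {sel : HiddenUnit n → Fin K}
    {x : EuclideanSpace ℝ (Fin (n 0))}
    (h : x ∈ cell θ sel ∨ ∀ z k, feature θ z k x ≤ feature θ z (sel z) x) (l : Fin (L + 1)) :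
    activation θ x l = selActivation θ sel x l := by
  induction l using Fin.induction with
  | zero => rfl
  | succ l ih =>
    funext i
    have hf : ∀ k, feature θ ⟨l, i⟩ k x = selFeature θ sel ⟨l, i⟩ k x := fun k => by
      rw [feature, selFeature, ih]
    rw [activation_succ, selActivation_succ, ciSup_eq_of_forall_le (k := sel ⟨l, i⟩), hf]
    intro j
    rcases h with h | h
    · rw [hf, hf]
      exact h ⟨l, i⟩ j
    · exact h ⟨l, i⟩ j

lemma feature_eq_selFeature {θ : Params n K} {sel : HiddenUnit n → Fin K}
    {x : EuclideanSpace ℝ (Fin (n 0))} (h : x ∈ cell θ sel) (z : HiddenUnit n) (k : Fin K) :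
    feature θ z k x = selFeature θ sel z k x := by
  rw [feature, selFeature, activation_eq_selActivation (.inl h)]

lemma mem_cell_iff {θ : Params n K} {sel : HiddenUnit n → Fin K}
    {x : EuclideanSpace ℝ (Fin (n 0))} :
    x ∈ cell θ sel ↔ ∀ z k, feature θ z k x ≤ feature θ z (sel z) x := by
  constructor
  · intro h z k
    rw [feature_eq_selFeature h, feature_eq_selFeature h]
    exact h z k
  · intro h z k
    have := h z k
    rwa [feature, feature, activation_eq_selActivation (.inr h)] at this

lemma exists_mem_cell [Nonempty (Fin K)] (θ : Params n K) (x : EuclideanSpace ℝ (Fin (n 0))) :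
    ∃ sel, x ∈ cell θ sel := by
  choose sel hsel using fun z => Finite.exists_max fun k => feature θ z k x
  exact ⟨sel, mem_cell_iff.2 hsel⟩

lemma mem_activationRegion {θ : Params n K} {J : HiddenUnit n → Finset (Fin K)}
    {x : EuclideanSpace ℝ (Fin (n 0))} :
    x ∈ activationRegion θ J ↔
      ∀ z k, (∀ j, feature θ z j x ≤ feature θ z k x) ↔ k ∈ J z := by
  simp [activationRegion, Set.ext_iff]

lemma measurableSet_activationRegion (J : HiddenUnit n → Finset (Fin K)) :
    MeasurableSet {p : Params n K × EuclideanSpace ℝ (Fin (n 0)) |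
      p.2 ∈ activationRegion p.1 J} := by
  simp only [mem_activationRegion, Set.ofPred_forall]
  refine MeasurableSet.iInter fun z => MeasurableSet.iInter fun k => ?_
  have h : MeasurableSet {p : Params n K × EuclideanSpace ℝ (Fin (n 0)) |
      ∀ j, feature p.1 z j p.2 ≤ feature p.1 z k p.2} := by
    simp only [Set.ofPred_forall]
    exact MeasurableSet.iInter fun j =>
      measurableSet_le (continuous_feature z j).measurable (continuous_feature z k).measurable
  by_cases hk : k ∈ J z
  · simpa [hk] using h
  · simp only [hk, iff_false]
    exact h.compl

lemma mem_cell_of_mem_activationRegion {θ : Params n K} {J : HiddenUnit n → Finset (Fin K)}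
    {x : EuclideanSpace ℝ (Fin (n 0))} (hx : x ∈ activationRegion θ J)
    {sel : HiddenUnit n → Fin K} (hsel : ∀ z, sel z ∈ J z) : x ∈ cell θ sel :=
  mem_cell_iff.2 fun z k => (mem_activationRegion.1 hx z (sel z)).2 (hsel z) k

lemma sel_mem_of_mem_cell {θ : Params n K} {J : HiddenUnit n → Finset (Fin K)}
    {x : EuclideanSpace ℝ (Fin (n 0))} (hx : x ∈ activationRegion θ J)
    {sel : HiddenUnit n → Fin K} (hc : x ∈ cell θ sel) (z : HiddenUnit n) : sel z ∈ J z :=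
  (mem_activationRegion.1 hx z (sel z)).1 (mem_cell_iff.1 hc z)

/-- A point all of whose neighbourhoods meet `S` in positive volume lies in a cell which meets `S`
in positive volume. -/
lemma exists_cell_of_forall_nhds [Nonempty (Fin K)] (θ : Params n K)
    {S : Set (EuclideanSpace ℝ (Fin (n 0)))} {x : EuclideanSpace ℝ (Fin (n 0))}
    (hx : ∀ V ∈ nhds x, volume (S ∩ V) ≠ 0) :
    ∃ sel, x ∈ cell θ sel ∧ volume (S ∩ cell θ sel) ≠ 0 := by
  by_contra! hcon
  have hV : (⋂ sel ∈ {sel | x ∉ cell θ sel}, (cell θ sel)ᶜ) ∈ nhds x :=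
    (Filter.biInter_mem (Set.toFinite _)).2 fun sel hsel =>
      (isClosed_cell θ sel).isOpen_compl.mem_nhds hsel
  refine hx _ hV (measure_mono_null (t := ⋃ sel ∈ {sel | x ∈ cell θ sel}, S ∩ cell θ sel) ?_ ?_)
  · rintro y ⟨hyS, hy⟩
    obtain ⟨sel, hsel⟩ := exists_mem_cell θ y
    simp only [Set.mem_iUnion]
    refine ⟨sel, ?_, hyS, hsel⟩
    by_contra hxs
    exact Set.mem_iInter₂.1 hy sel hxs hsel
  · exact (measure_biUnion_null_iff (Set.to_countable _)).2 fun sel hsel => hcon sel hsel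

lemma volume_setOf_exists_nhds_null {d : ℕ} (S : Set (EuclideanSpace ℝ (Fin d))) :
    volume {x ∈ S | ∃ V ∈ nhds x, volume (S ∩ V) = 0} = 0 := by
  refine measure_null_of_locally_null _ ?_
  rintro x ⟨-, V, hV, h0⟩
  refine ⟨{x ∈ S | ∃ V ∈ nhds x, volume (S ∩ V) = 0} ∩ V,
    Filter.inter_mem self_mem_nhdsWithin (mem_nhdsWithin_of_mem_nhds hV), ?_⟩
  exact measure_mono_null (Set.inter_subset_inter_left _ fun y hy => hy.1) h0

/-- An almost everywhere bound for the gradients of the features on `S` bounds the gradients of the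
affine pieces on all cells that meet `S` in positive volume. -/
lemma norm_selGrad_le {θ : Params n K} {S : Set (EuclideanSpace ℝ (Fin (n 0)))} {C : ℝ}
    {z : HiddenUnit n} {k : Fin K}
    (hS : ∀ᵐ x ∂volume.restrict S, ‖gradient (feature θ z k) x‖ ≤ C)
    {sel : HiddenUnit n → Fin K} (hsel : volume (S ∩ cell θ sel) ≠ 0) :
    ‖selGrad θ.1 sel z k‖ ≤ C := by
  have hfr : volume (frontier (cell θ sel)) = 0 := (convex_cell θ sel).addHaar_frontier volume
  have hpos : (volume.restrict S) (interior (cell θ sel)) ≠ 0 := by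
    intro h0
    refine hsel ?_
    rw [Set.inter_comm, ← Measure.restrict_apply (isClosed_cell θ sel).measurableSet]
    refine measure_mono_null (t := interior (cell θ sel) ∪ frontier (cell θ sel)) ?_ ?_
    · rw [← closure_eq_interior_union_frontier]
      exact subset_closure
    · exact measure_union_null h0 (Measure.absolutelyContinuous_of_le Measure.restrict_le_self hfr)
  obtain ⟨x, hx, hle⟩ := ((frequently_ae_mem_iff.2 hpos).and_eventually hS).exists
  have heq : feature θ z k =ᶠ[nhds x] selFeature θ sel z k := by
    filter_upwards [mem_interior_iff_mem_nhds.1 hx] with y hy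
    exact feature_eq_selFeature hy z k
  have hgrad := (hasGradientAt_selFeature θ sel z k x).congr_of_eventuallyEq heq
  rwa [hgrad.gradient] at hle

end Network

/-! ### Tie equations of activation regions -/

section Ties

variable {L K : ℕ} {n : Fin (L + 1) → ℕ}

/-- The parameter with given weights, biases outside `T`, and biases in `T`; the inverse of
`splitParams`. -/
def joinParams (T : Finset (BiasIndex n K))
    (p : ((WeightIndex n K → ℝ) × ({i // i ∉ T} → ℝ)) × ({i // i ∈ T} → ℝ)) : Params n K :=
  (p.1.1, fun i => if h : i ∈ T then p.2 ⟨i, h⟩ else p.1.2 ⟨i, h⟩)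

lemma joinParams_snd_of_notMem {T : Finset (BiasIndex n K)}
    (p : ((WeightIndex n K → ℝ) × ({i // i ∉ T} → ℝ)) × ({i // i ∈ T} → ℝ)) {i : BiasIndex n K}
    (hi : i ∉ T) : (joinParams T p).2 i = p.1.2 ⟨i, hi⟩ := dif_neg hi

lemma continuous_joinParams (T : Finset (BiasIndex n K)) : Continuous (joinParams T) := by
  refine (by fun_prop : Continuous fun p : ((WeightIndex n K → ℝ) × ({i // i ∉ T} → ℝ)) ×
    ({i // i ∈ T} → ℝ) => p.1.1).prodMk (continuous_pi fun i => ?_)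
  by_cases h : i ∈ T
  · simp only [h, dite_true]
    fun_prop
  · simp only [h, dite_false]
    fun_prop

lemma measurable_joinParams (T : Finset (BiasIndex n K)) : Measurable (joinParams T) := by
  refine (by fun_prop : Measurable fun p : ((WeightIndex n K → ℝ) × ({i // i ∉ T} → ℝ)) ×
    ({i // i ∈ T} → ℝ) => p.1.1).prodMk (measurable_pi_iff.2 fun i => ?_)
  by_cases h : i ∈ T
  · simp only [h, dite_true]
    fun_prop
  · simp only [h, dite_false]
    fun_prop

/-- `splitParams` as a measurable equivalence. -/
def splitEquiv (T : Finset (BiasIndex n K)) :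
    Params n K ≃ᵐ ((WeightIndex n K → ℝ) × ({i // i ∉ T} → ℝ)) × ({i // i ∈ T} → ℝ) where
  toFun := splitParams T
  invFun := joinParams T
  left_inv θ := by
    refine Prod.ext rfl (funext fun i => ?_)
    simp [joinParams, splitParams]
  right_inv p := by
    refine Prod.ext (Prod.ext rfl (funext fun i => ?_)) (funext fun i => ?_)
    · simp [joinParams, splitParams, i.2]
    · simp [joinParams, splitParams]
  measurable_toFun := by
    change Measurable fun θ => splitParams T θ
    unfold splitParams
    fun_prop
  measurable_invFun := measurable_joinParams T

lemma selActivation_congr {θ θ' : Params n K} {sel : HiddenUnit n → Fin K} (h1 : θ.1 = θ'.1)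
    (h2 : ∀ z, θ.2 (z, sel z) = θ'.2 (z, sel z)) (x : EuclideanSpace ℝ (Fin (n 0)))
    (l : Fin (L + 1)) : selActivation θ sel x l = selActivation θ' sel x l := by
  induction l using Fin.induction with
  | zero => rfl
  | succ l ih =>
    funext i
    rw [selActivation_succ, selActivation_succ, selFeature, selFeature, ih, affineFeature,
      affineFeature, h1, h2]

variable (T : Finset (BiasIndex n K)) (base : HiddenUnit n → Fin K)

lemma selFeature_joinParams (hT : ∀ z, (z, base z) ∉ T)
    (o : (WeightIndex n K → ℝ) × ({i // i ∉ T} → ℝ)) (b : {i // i ∈ T} → ℝ) (z : HiddenUnit n)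
    (k : Fin K) (x : EuclideanSpace ℝ (Fin (n 0))) :
    selFeature (joinParams T (o, b)) base z k x =
      selFeature (joinParams T (o, 0)) base z k x + if h : (z, k) ∈ T then b ⟨(z, k), h⟩ else 0 := by
  have hact := selActivation_congr (θ := joinParams T (o, b)) (θ' := joinParams T (o, 0))
    (sel := base) rfl (fun z => by simp [joinParams, hT z]) x z.1.castSucc
  rw [selFeature, selFeature, hact, affineFeature, affineFeature]
  by_cases h : (z, k) ∈ T <;> simp [joinParams, h]

/-- The gradient of the difference of the feature with index `i` and the feature with the index
`base` of the same unit. -/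
def tieGrad (w : WeightIndex n K → ℝ) (i : BiasIndex n K) : EuclideanSpace ℝ (Fin (n 0)) :=
  selGrad w base i.1 i.2 - selGrad w base i.1 (base i.1)

/-- The constant term of the affine function with gradient `tieGrad`, without the contribution of
the bias with index `i`. -/
def tieConst (o : (WeightIndex n K → ℝ) × ({i // i ∉ T} → ℝ)) (i : BiasIndex n K) : ℝ :=
  selFeature (joinParams T (o, 0)) base i.1 i.2 0 -
    selFeature (joinParams T (o, 0)) base i.1 (base i.1) 0

/-- The values of the biases in `T` for which all features in `T` are tied with the base features
at the input `x`. -/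
def tieBias (o : (WeightIndex n K → ℝ) × ({i // i ∉ T} → ℝ)) (x : EuclideanSpace ℝ (Fin (n 0)))
    (i : {i // i ∈ T}) : ℝ :=
  -(inner ℝ (tieGrad base o.1 i) x + tieConst T base o i)

lemma continuous_tieGrad (i : BiasIndex n K) :
    Continuous fun w : WeightIndex n K → ℝ => tieGrad base w i :=
  (continuous_selGrad base _ _).sub (continuous_selGrad base _ _)

lemma continuous_tieConst (i : BiasIndex n K) : Continuous fun o => tieConst T base o i := by
  have h : Continuous fun o : (WeightIndex n K → ℝ) × ({i // i ∉ T} → ℝ) =>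
      (joinParams T (o, 0), (0 : EuclideanSpace ℝ (Fin (n 0)))) :=
    ((continuous_joinParams T).comp (by fun_prop)).prodMk continuous_const
  exact ((continuous_selFeature base i.1 i.2).comp h).sub
    ((continuous_selFeature base i.1 (base i.1)).comp h)

lemma continuous_tieBias (o : (WeightIndex n K → ℝ) × ({i // i ∉ T} → ℝ)) :
    Continuous (tieBias T base o) := by
  unfold tieBias
  fun_prop

variable {T base}
variable {J : HiddenUnit n → Finset (Fin K)}

lemma tie_eq_zero (hbase : ∀ z, base z ∈ J z)
    (hT : ∀ i : BiasIndex n K, i ∈ T ↔ i.2 ∈ J i.1 ∧ i.2 ≠ base i.1)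
    {o : (WeightIndex n K → ℝ) × ({i // i ∉ T} → ℝ)} {b : {i // i ∈ T} → ℝ}
    {x : EuclideanSpace ℝ (Fin (n 0))} (hx : x ∈ activationRegion (joinParams T (o, b)) J)
    (i : {i // i ∈ T}) :
    inner ℝ (tieGrad base o.1 i) x + tieConst T base o i + b i = 0 := by
  obtain ⟨⟨z, k⟩, hi⟩ := i
  have hnot : ∀ z, (z, base z) ∉ T := fun z hz => ((hT _).1 hz).2 rfl
  have hcell := mem_cell_of_mem_activationRegion hx hbase
  have h1 := (mem_activationRegion.1 hx z k).2 ((hT _).1 hi).1 (base z)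
  have h2 := mem_cell_iff.1 hcell z k
  have heq := le_antisymm h2 h1
  rw [feature_eq_selFeature hcell, feature_eq_selFeature hcell,
    selFeature_joinParams T base hnot o b z k, dif_pos hi,
    selFeature_eq_inner_add _ _ z k, selFeature_eq_inner_add _ _ z (base z)] at heq
  simp only [tieGrad, tieConst, inner_sub_left]
  rw [selFeature_joinParams T base hnot o b z (base z), dif_neg (hnot z)] at heq
  change inner ℝ (selGrad o.1 base z k) x + selFeature (joinParams T (o, 0)) base z k 0 +
    b ⟨(z, k), hi⟩ = inner ℝ (selGrad o.1 base z (base z)) x +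
      (selFeature (joinParams T (o, 0)) base z (base z) 0 + 0) at heq
  linarith

lemma eq_tieBias (hbase : ∀ z, base z ∈ J z)
    (hT : ∀ i : BiasIndex n K, i ∈ T ↔ i.2 ∈ J i.1 ∧ i.2 ≠ base i.1)
    {o : (WeightIndex n K → ℝ) × ({i // i ∉ T} → ℝ)} {b : {i // i ∈ T} → ℝ}
    {x : EuclideanSpace ℝ (Fin (n 0))} (hx : x ∈ activationRegion (joinParams T (o, b)) J) :
    b = tieBias T base o x := by
  funext i
  have := tie_eq_zero hbase hT hx i
  rw [tieBias]
  linarith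

/-- The pattern of an input is determined by the parameters outside `T`, provided that the units
which have biases in `T` have a prescribed pattern with at least one bias outside `T`. -/
lemma pattern_unique {θ θ' : Params n K} (hw : θ.1 = θ'.1) (hb : ∀ i ∉ T, θ.2 i = θ'.2 i)
    {J' : HiddenUnit n → Finset (Fin K)} {x : EuclideanSpace ℝ (Fin (n 0))}
    (hx : x ∈ activationRegion θ J) (hx' : x ∈ activationRegion θ' J')
    (hJ : ∀ z, (J z = J' z ∧ ∃ k ∈ J z, (z, k) ∉ T) ∨ ∀ k, (z, k) ∉ T) : J = J' := by
  have hfeat : ∀ z, activation θ x z.1.castSucc = activation θ' x z.1.castSucc →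
      ∀ k, (z, k) ∉ T → feature θ z k x = feature θ' z k x := by
    intro z hz k hk
    rw [feature, feature, hz, affineFeature, affineFeature, hw, hb _ hk]
  have hact : ∀ l, activation θ x l = activation θ' x l := by
    intro l
    induction l using Fin.induction with
    | zero => rfl
    | succ l ih =>
      funext i
      rw [activation_succ, activation_succ]
      rcases hJ ⟨l, i⟩ with ⟨hJz, k, hk, hkT⟩ | hz
      · rw [ciSup_eq_of_forall_le ((mem_activationRegion.1 hx ⟨l, i⟩ k).2 hk),
          ciSup_eq_of_forall_le ((mem_activationRegion.1 hx' ⟨l, i⟩ k).2 (hJz ▸ hk)),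
          hfeat ⟨l, i⟩ ih k hkT]
      · exact iSup_congr fun k => hfeat ⟨l, i⟩ ih k (hz k)
  funext z
  rcases hJ z with ⟨hJz, -⟩ | hz
  · exact hJz
  · ext k
    rw [← mem_activationRegion.1 hx z k, ← mem_activationRegion.1 hx' z k]
    simp only [hfeat z (hact _) _ (hz _)]

/-- A different choice of branches among the tied features changes the gradients by combinations
of the gradients of the ties in the preceding layers. -/
lemma selActivationGrad_sub_mem_span (w : WeightIndex n K → ℝ)
    (hT : ∀ i : BiasIndex n K, i ∈ T ↔ i.2 ∈ J i.1 ∧ i.2 ≠ base i.1)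
    {sel : HiddenUnit n → Fin K} (hsel : ∀ z, sel z ∈ J z) (l : Fin (L + 1)) (i : Fin (n l)) :
    selActivationGrad w sel l i - selActivationGrad w base l i ∈
      Submodule.span ℝ ((fun i : {i // i ∈ T} => tieGrad base w i) ''
        {j | (j.1.1.1 : ℕ) < l}) := by
  induction l using Fin.induction with
  | zero =>
    rw [show selActivationGrad w sel 0 i = selActivationGrad w base 0 i from rfl, sub_self]
    exact Submodule.zero_mem _
  | succ l ih =>
    rw [selActivationGrad_succ, selActivationGrad_succ]
    have h1 : selGrad w sel ⟨l, i⟩ (sel ⟨l, i⟩) - selGrad w base ⟨l, i⟩ (sel ⟨l, i⟩) ∈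
        Submodule.span ℝ ((fun i : {i // i ∈ T} => tieGrad base w i) ''
          {j | (j.1.1.1 : ℕ) < l.succ}) := by
      rw [selGrad, selGrad, ← Finset.sum_sub_distrib]
      refine Submodule.sum_mem _ fun j _ => ?_
      rw [← smul_sub]
      refine Submodule.smul_mem _ _ (Submodule.span_mono (Set.image_mono ?_) (ih j))
      intro j hj
      exact Nat.lt_succ_of_lt hj
    have h2 : selGrad w base ⟨l, i⟩ (sel ⟨l, i⟩) - selGrad w base ⟨l, i⟩ (base ⟨l, i⟩) ∈
        Submodule.span ℝ ((fun i : {i // i ∈ T} => tieGrad base w i) ''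
          {j | (j.1.1.1 : ℕ) < l.succ}) := by
      by_cases heq : sel ⟨l, i⟩ = base ⟨l, i⟩
      · rw [heq, sub_self]
        exact Submodule.zero_mem _
      · have hmem : ((⟨l, i⟩, sel ⟨l, i⟩) : BiasIndex n K) ∈ T := (hT _).2 ⟨hsel _, heq⟩
        exact Submodule.subset_span ⟨⟨_, hmem⟩, by simp, rfl⟩
    have := Submodule.add_mem _ h1 h2
    rwa [sub_add_sub_cancel] at this

lemma selGrad_sub_mem_span (w : WeightIndex n K → ℝ)
    (hT : ∀ i : BiasIndex n K, i ∈ T ↔ i.2 ∈ J i.1 ∧ i.2 ≠ base i.1)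
    {sel : HiddenUnit n → Fin K} (hsel : ∀ z, sel z ∈ J z) (i : BiasIndex n K) :
    selGrad w sel i.1 i.2 - selGrad w sel i.1 (base i.1) - tieGrad base w i ∈
      Submodule.span ℝ ((fun i : {i // i ∈ T} => tieGrad base w i) ''
        {j | (j.1.1.1 : ℕ) < i.1.1}) := by
  have h : ∀ k, selGrad w sel i.1 k - selGrad w base i.1 k ∈
      Submodule.span ℝ ((fun i : {i // i ∈ T} => tieGrad base w i) ''
        {j | (j.1.1.1 : ℕ) < i.1.1}) := by
    intro k
    rw [selGrad, selGrad, ← Finset.sum_sub_distrib]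
    refine Submodule.sum_mem _ fun j _ => ?_
    rw [← smul_sub]
    exact Submodule.smul_mem _ _ (selActivationGrad_sub_mem_span w hT hsel _ j)
  have := Submodule.sub_mem _ (h i.2) (h (base i.1))
  rwa [tieGrad, show ∀ a b c d : EuclideanSpace ℝ (Fin (n 0)), a - b - (c - d) = a - c - (b - d)
    from fun a b c d => by abel]

/-- The parameters for which the gradients of all features are bounded by `C` almost everywhere
on `S`. -/
def boundedGrad (n : Fin (L + 1) → ℕ) (K : ℕ) (S : Set (EuclideanSpace ℝ (Fin (n 0)))) (C : ℝ) :
    Set (Params n K) :=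
  {θ | ∀ z k, ∀ᵐ x ∂volume.restrict S, ‖gradient (feature θ z k) x‖ ≤ C}

/-- The inputs in `S` that have pattern `J` for those biases in `T` which tie the features in `T`,
if the resulting parameter has bounded gradients. -/
def tieDomain (T : Finset (BiasIndex n K)) (base : HiddenUnit n → Fin K)
    (J : HiddenUnit n → Finset (Fin K)) (S : Set (EuclideanSpace ℝ (Fin (n 0)))) (C : ℝ)
    (o : (WeightIndex n K → ℝ) × ({i // i ∉ T} → ℝ)) : Set (EuclideanSpace ℝ (Fin (n 0))) :=
  {x | x ∈ S ∧ x ∈ activationRegion (joinParams T (o, tieBias T base o x)) J ∧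
    joinParams T (o, tieBias T base o x) ∈ boundedGrad n K S C}

lemma measurable_joinParams_tieBias (T : Finset (BiasIndex n K)) (base : HiddenUnit n → Fin K)
    (o : (WeightIndex n K → ℝ) × ({i // i ∉ T} → ℝ)) :
    Measurable fun x => joinParams T (o, tieBias T base o x) :=
  (measurable_joinParams T).comp
    (measurable_const.prodMk (continuous_tieBias T base o).measurable)

lemma measurableSet_region_comp (J : HiddenUnit n → Finset (Fin K))
    {f : EuclideanSpace ℝ (Fin (n 0)) → Params n K} (hf : Measurable f) :
    MeasurableSet {x | x ∈ activationRegion (f x) J} :=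
  (measurableSet_activationRegion J).preimage (hf.prodMk measurable_id')

lemma measurableSet_setOf_and_and {α : Type*} [MeasurableSpace α] {p q r : α → Prop}
    (hp : MeasurableSet {x | p x}) (hq : MeasurableSet {x | q x}) (hr : MeasurableSet {x | r x}) :
    MeasurableSet {x | p x ∧ q x ∧ r x} :=
  hp.inter (hq.inter hr)

lemma measurableSet_region_prod {X : Type*} [MeasurableSpace X]
    (J : HiddenUnit n → Finset (Fin K)) {S : Set (EuclideanSpace ℝ (Fin (n 0)))}
    (hS : MeasurableSet S) {f : X → Params n K} (hf : Measurable f) :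
    MeasurableSet {q : X × EuclideanSpace ℝ (Fin (n 0)) |
      q.2 ∈ activationRegion (f q.1) J ∩ S} :=
  MeasurableSet.inter (((hf.comp measurable_fst).prodMk measurable_snd)
    (measurableSet_activationRegion J)) (measurable_snd hS)

lemma measurableSet_tieDomain {S : Set (EuclideanSpace ℝ (Fin (n 0)))} (hS : MeasurableSet S)
    {C : ℝ} (hC : MeasurableSet (boundedGrad n K S C))
    (o : (WeightIndex n K → ℝ) × ({i // i ∉ T} → ℝ)) :
    MeasurableSet (tieDomain T base J S C o) := by
  have h := measurable_joinParams_tieBias T base o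
  exact measurableSet_setOf_and_and hS (measurableSet_region_comp J h) (hC.preimage h)

/-- For fixed parameters outside `T`, the volume of the activation region of `J`, integrated over
the biases in `T`, is bounded by the `n 0`-dimensional volume of `tieDomain`. -/
lemma lintegral_activationRegion_le (hbase : ∀ z, base z ∈ J z)
    (hT : ∀ i : BiasIndex n K, i ∈ T ↔ i.2 ∈ J i.1 ∧ i.2 ≠ base i.1)
    {m : ℕ} (hm : T.card + m = n 0)
    {S : Set (EuclideanSpace ℝ (Fin (n 0)))} (hS : MeasurableSet S)
    {C : ℝ} (hC : MeasurableSet (boundedGrad n K S C))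
    (o : (WeightIndex n K → ℝ) × ({i // i ∉ T} → ℝ)) :
    ∫⁻ b, (boundedGrad n K S C).indicator (fun θ => μHE[m] (activationRegion θ J ∩ S))
        (joinParams T (o, b)) ≤
      ENNReal.ofReal (2 * C) ^ T.card * volume (tieDomain T base J S C o) := by
  have hD := measurableSet_tieDomain (T := T) (base := base) (J := J) hS hC o
  set D := tieDomain T base J S C o with hDdef
  have hle : ∀ b, (boundedGrad n K S C).indicator (fun θ => μHE[m] (activationRegion θ J ∩ S))
      (joinParams T (o, b)) ≤
      μHE[m] {x ∈ D | ∀ i : {i // i ∈ T},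
        inner ℝ (tieGrad base o.1 i) x + tieConst T base o i + b i = 0} := by
    intro b
    refine Set.indicator_apply_le' (fun hgood => measure_mono ?_) fun _ => zero_le
    rintro x ⟨hx, hxS⟩
    refine ⟨?_, tie_eq_zero hbase hT hx⟩
    have hb := eq_tieBias hbase hT hx
    exact ⟨hxS, hb ▸ hx, hb ▸ hgood⟩
  refine (lintegral_mono hle).trans ?_
  have hcard : Fintype.card {i // i ∈ T} + m = n 0 := by rw [Fintype.card_coe, hm]
  have hcoarea := fun v hv => lintegral_affine_fiber_le (ι := {i // i ∈ T}) hcard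
    (fun i => (i.1.1.1 : ℕ)) (fun i => tieGrad base o.1 i) v hv (fun i => tieConst T base o i) hD
  by_cases h0 : volume D = 0
  · refine (hcoarea (fun i => tieGrad base o.1 i) fun i => by simp).trans ?_
    simp [h0]
  · -- some point of `D` has neighbourhoods which all meet `S` in positive volume
    obtain ⟨x, ⟨hxS, hxJ, hgood⟩, hx⟩ : ∃ x ∈ D, ∀ V ∈ nhds x, volume (S ∩ V) ≠ 0 := by
      by_contra! hcon
      exact h0 (measure_mono_null (t := {x ∈ S | ∃ V ∈ nhds x, volume (S ∩ V) = 0})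
        (fun x hx => ⟨hx.1, hcon x hx⟩) (volume_setOf_exists_nhds_null S))
    by_cases hTe : T = ∅
    · subst hTe
      refine (hcoarea (fun i => tieGrad base o.1 i) fun i => by simp).trans ?_
      simp
    obtain ⟨i₀, -⟩ := Finset.nonempty_iff_ne_empty.2 hTe
    have hK : Nonempty (Fin K) := ⟨i₀.2⟩
    obtain ⟨sel, hcell, hpos⟩ :=
      exists_cell_of_forall_nhds (joinParams T (o, tieBias T base o x)) hx
    have hsel := sel_mem_of_mem_cell hxJ hcell
    have hbound : ∀ z k, ‖selGrad o.1 sel z k‖ ≤ C := fun z k => norm_selGrad_le (hgood z k) hpos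
    refine (hcoarea (fun i => selGrad o.1 sel i.1.1 i.1.2 - selGrad o.1 sel i.1.1 (base i.1.1))
      fun i => selGrad_sub_mem_span o.1 hT hsel i.1).trans ?_
    gcongr
    rw [← Fintype.card_coe, ← Finset.card_univ, ← Finset.prod_const]
    refine Finset.prod_le_prod' fun i _ => ?_
    rw [← ofReal_norm]
    refine ENNReal.ofReal_le_ofReal ((norm_sub_le _ _).trans ?_)
    linarith [hbound i.1.1 i.1.2, hbound i.1.1 (base i.1.1)]

/-- The volume of an activation region depends almost everywhere measurably on the parameters. -/
lemma aemeasurable_activationRegion (hbase : ∀ z, base z ∈ J z)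
    (hT : ∀ i : BiasIndex n K, i ∈ T ↔ i.2 ∈ J i.1 ∧ i.2 ≠ base i.1)
    {m : ℕ} (hm : T.card + m = n 0)
    {S : Set (EuclideanSpace ℝ (Fin (n 0)))} (hS : MeasurableSet S)
    (μ : Measure ((WeightIndex n K → ℝ) × ({i // i ∉ T} → ℝ))) [SFinite μ] :
    AEMeasurable (fun p => μHE[m] (activationRegion (joinParams T p) J ∩ S))
      (μ.prod volume) := by
  have hcard : Fintype.card {i // i ∈ T} + m = n 0 := by rw [Fintype.card_coe, hm]
  have := aemeasurable_section_volume (m := m) μ hcard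
    (g := fun o (i : {i // i ∈ T}) => tieGrad base o.1 i)
    (measurable_pi_iff.2 fun i => ((continuous_tieGrad base _).comp continuous_fst).measurable)
    (c := fun o (i : {i // i ∈ T}) => tieConst T base o i)
    (measurable_pi_iff.2 fun i => (continuous_tieConst T base _).measurable)
    (measurableSet_region_prod J hS (measurable_joinParams T))
  convert this using 3 with p
  ext x
  constructor
  · intro hx
    exact ⟨hx, tie_eq_zero hbase hT hx.1⟩
  · exact fun hx => hx.1

end Ties

/-! ### Expected volume of an activation region -/

/-- A function all of whose moments are bounded by the powers of `c` is bounded by `c` almost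
everywhere. -/
lemma ae_le_of_forall_lintegral_pow_le {Ω : Type*} [MeasurableSpace Ω] {P : Measure Ω}
    [IsFiniteMeasure P] {f : Ω → ENNReal} (hf : AEMeasurable f P) {c : ENNReal} (hc : c ≠ ⊤)
    (h : ∀ t : ℕ, ∫⁻ ω, f ω ^ t ∂P ≤ c ^ t) : ∀ᵐ ω ∂P, f ω ≤ c := by
  have key : ∀ a, c < a → a ≠ ⊤ → P {ω | a ≤ f ω} = 0 := by
    intro a hca ha
    have ha0 : a ≠ 0 := (zero_le.trans_lt hca).ne'
    have hbound : ∀ t : ℕ, P {ω | a ≤ f ω} ≤ (c / a) ^ t := by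
      intro t
      have hsub : P {ω | a ≤ f ω} ≤ P {ω | a ^ t ≤ f ω ^ t} :=
        measure_mono fun ω (hω : a ≤ f ω) => pow_le_pow_left' hω t
      have hmk := (mul_meas_ge_le_lintegral₀ (hf.pow_const t) (a ^ t)).trans (h t)
      rw [div_eq_mul_inv, mul_pow, ← ENNReal.inv_pow, ← div_eq_mul_inv,
        ENNReal.le_div_iff_mul_le (.inl (pow_ne_zero t ha0))
        (.inl (ENNReal.pow_ne_top ha)), mul_comm]
      exact (mul_le_mul_right hsub _).trans hmk
    have hlt : c / a < 1 := by
      rw [ENNReal.div_lt_iff (.inl ha0) (.inl ha), one_mul]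
      exact hca
    exact le_antisymm (ge_of_tendsto' (ENNReal.tendsto_pow_atTop_nhds_zero_of_lt_one hlt) hbound)
      zero_le
  obtain ⟨u, -, hu, hlim⟩ := exists_seq_strictAnti_tendsto' (lt_top_iff_ne_top.2 hc)
  have hae : ∀ᵐ ω ∂P, ∀ k, f ω < u k := ae_all_iff.2 fun k => by
    rw [ae_iff]
    simpa using key (u k) (hu k).1 (hu k).2.ne
  filter_upwards [hae] with ω hω
  exact ge_of_tendsto' hlim fun k => (hω k).le

lemma ae_ae_le_of_forall_lintegral_pow_le {Ω X : Type*} [MeasurableSpace Ω] [MeasureSpace X]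
    [SFinite (volume : Measure X)] (P : Measure Ω) [IsFiniteMeasure P] {S : Set X}
    (hS : MeasurableSet S) {C : ℝ} (hC : 0 < C) {φ : Ω → X → ℝ}
    (hφ : Measurable fun p : Ω × X => φ p.1 p.2)
    (h : ∀ (t : ℕ), ∀ x ∈ S, ∫⁻ ω, ENNReal.ofReal (φ ω x) ^ t ∂P ≤ ENNReal.ofReal (C ^ t)) :
    ∀ᵐ ω ∂P, ∀ᵐ x ∂volume.restrict S, φ ω x ≤ C := by
  refine (Measure.ae_ae_comm (p := fun ω x => φ ω x ≤ C)
    (measurableSet_le hφ measurable_const)).2 ?_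
  refine (ae_restrict_mem hS).mono fun x hx => ?_
  have hmx : Measurable fun ω => φ ω x := hφ.comp (measurable_id.prodMk measurable_const)
  have := ae_le_of_forall_lintegral_pow_le (P := P) hmx.ennreal_ofReal.aemeasurable
    ENNReal.ofReal_ne_top fun t => (h t x hx).trans_eq (ENNReal.ofReal_pow hC.le t)
  filter_upwards [this] with ω hω
  rwa [ENNReal.ofReal_le_ofReal_iff hC.le] at hω

lemma sum_lintegral_le_lintegral_sum {Ω ι : Type*} [MeasurableSpace Ω] (P : Measure Ω)
    (s : Finset ι) (f : ι → Ω → ENNReal) :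
    ∑ i ∈ s, ∫⁻ ω, f i ω ∂P ≤ ∫⁻ ω, ∑ i ∈ s, f i ω ∂P := by
  classical
  induction s using Finset.induction_on with
  | empty => simp
  | insert a s ha ih =>
    simp only [Finset.sum_insert ha]
    exact (add_le_add_right ih _).trans (le_lintegral_add _ _)

section Expectation

variable {L K : ℕ} {n : Fin (L + 1) → ℕ}

lemma measurable_norm_gradient_feature (z : HiddenUnit n) (k : Fin K) :
    Measurable fun p : Params n K × EuclideanSpace ℝ (Fin (n 0)) =>
      ‖gradient (feature p.1 z k) p.2‖ := by
  simp only [gradient, LinearIsometryEquiv.norm_map]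
  exact (measurable_fderiv_with_param ℝ (f := fun θ : Params n K => feature θ z k)
    (continuous_feature z k)).norm

lemma measurableSet_boundedGrad (S : Set (EuclideanSpace ℝ (Fin (n 0)))) (C : ℝ) :
    MeasurableSet (boundedGrad n K S C) := by
  simp only [boundedGrad, Set.ofPred_forall]
  refine MeasurableSet.iInter fun z => MeasurableSet.iInter fun k => ?_
  have h := measurable_measure_prodMk_left (ν := volume.restrict S)
    (measurableSet_lt measurable_const (measurable_norm_gradient_feature (n := n) z k) :
      MeasurableSet {p : Params n K × EuclideanSpace ℝ (Fin (n 0)) |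
        C < ‖gradient (feature p.1 z k) p.2‖})
  have heq : {θ : Params n K | ∀ᵐ x ∂volume.restrict S, ‖gradient (feature θ z k) x‖ ≤ C} =
      (fun θ => volume.restrict S (Prod.mk θ ⁻¹' {p : Params n K × EuclideanSpace ℝ (Fin (n 0)) |
        C < ‖gradient (feature p.1 z k) p.2‖})) ⁻¹' {0} := by
    ext θ
    simp only [Set.mem_ofPred_eq, ae_iff, not_le, Set.mem_preimage, Set.mem_singleton_iff]
    rfl
  rw [heq]
  exact h (measurableSet_singleton 0)

/-- The moment bounds for all orders bound the gradients almost everywhere, for almost all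
parameters. -/
lemma ae_mem_boundedGrad (P : Measure (Params n K)) [IsProbabilityMeasure P]
    {S : Set (EuclideanSpace ℝ (Fin (n 0)))} (hS : MeasurableSet S) {C : ℝ} (hC : 0 < C)
    (h_grad : ∀ (t : ℕ) (z : HiddenUnit n) (k : Fin K),
      (⨆ x ∈ S, ∫⁻ θ, ‖gradient (feature θ z k) x‖ₑ ^ t ∂P) ≤ ENNReal.ofReal (C ^ t)) :
    ∀ᵐ θ ∂P, θ ∈ boundedGrad n K S C := by
  have h : ∀ z k, ∀ᵐ θ ∂P, ∀ᵐ x ∂volume.restrict S, ‖gradient (feature θ z k) x‖ ≤ C := fun z k =>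
    ae_ae_le_of_forall_lintegral_pow_le P hS hC (measurable_norm_gradient_feature z k)
      fun t x hx => by
        simp only [ofReal_norm]
        exact (le_iSup₂ (f := fun x (_ : x ∈ S) => ∫⁻ θ, ‖gradient (feature θ z k) x‖ₑ ^ t ∂P)
          x hx).trans (h_grad t z k)
  filter_upwards [ae_all_iff.2 fun z => ae_all_iff.2 fun k => h z k] with θ hθ
  exact hθ

lemma isProbabilityMeasure_restLaw (P : Measure (Params n K)) [IsProbabilityMeasure P]
    (T : Finset (BiasIndex n K)) : IsProbabilityMeasure (restLaw P T) :=
  Measure.isProbabilityMeasure_map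
    (measurable_fst.comp (splitEquiv T).measurable :
      Measurable fun θ => (splitParams T θ).1).aemeasurable

lemma map_splitParams_le {P : Measure (Params n K)} [IsProbabilityMeasure P]
    {T : Finset (BiasIndex n K)} {ρ} (hρ : IsBiasCondDensity P T ρ) {c : ENNReal}
    (hc : ∀ᵐ o ∂(restLaw P T), ∀ᵐ b ∂(volume : Measure ({i // i ∈ T} → ℝ)), ρ (o, b) ≤ c) :
    P.map (splitParams T) ≤
      c • (restLaw P T).prod (volume : Measure ({i // i ∈ T} → ℝ)) := by
  have := isProbabilityMeasure_restLaw P T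
  rw [hρ.2, ← withDensity_const]
  refine withDensity_mono ?_
  exact (Measure.ae_prod_iff_ae_ae (measurableSet_le hρ.1 measurable_const)).2 hc

variable {T : Finset (BiasIndex n K)} {base : HiddenUnit n → Fin K}
  {J : HiddenUnit n → Finset (Fin K)}

/-- The volume of an activation region is a random variable. -/
lemma aemeasurable_volume_activationRegion (hbase : ∀ z, base z ∈ J z)
    (hT : ∀ i : BiasIndex n K, i ∈ T ↔ i.2 ∈ J i.1 ∧ i.2 ≠ base i.1)
    {m : ℕ} (hm : T.card + m = n 0) {S : Set (EuclideanSpace ℝ (Fin (n 0)))}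
    (hS : MeasurableSet S) (P : Measure (Params n K)) [IsProbabilityMeasure P] {ρ}
    (hρ : IsBiasCondDensity P T ρ) :
    AEMeasurable (fun θ => μHE[m] (activationRegion θ J ∩ S)) P := by
  have := isProbabilityMeasure_restLaw P T
  have h := aemeasurable_activationRegion hbase hT hm hS (restLaw P T)
  have hac : P.map (splitEquiv T) ≪ (restLaw P T).prod volume := by
    change P.map (splitParams T) ≪ _
    rw [hρ.2]
    exact withDensity_absolutelyContinuous _ _
  have h2 := (h.mono_ac hac).comp_measurable (splitEquiv T).measurable
  convert h2 using 1
  funext θ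
  rw [Function.comp_apply]
  congr
  exact ((splitEquiv T).left_inv θ).symm

/-- The expected volume of an activation region is bounded by the expected volume of
`tieDomain`. -/
lemma lintegral_volume_activationRegion_le (hbase : ∀ z, base z ∈ J z)
    (hT : ∀ i : BiasIndex n K, i ∈ T ↔ i.2 ∈ J i.1 ∧ i.2 ≠ base i.1)
    {m : ℕ} (hm : T.card + m = n 0) {S : Set (EuclideanSpace ℝ (Fin (n 0)))}
    (hS : MeasurableSet S) (P : Measure (Params n K)) [IsProbabilityMeasure P] {C : ℝ}
    (hgood : ∀ᵐ θ ∂P, θ ∈ boundedGrad n K S C) {c : ENNReal} {ρ}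
    (hρ : IsBiasCondDensity P T ρ)
    (hc : ∀ᵐ o ∂(restLaw P T), ∀ᵐ b ∂(volume : Measure ({i // i ∈ T} → ℝ)), ρ (o, b) ≤ c) :
    ∫⁻ θ, μHE[m] (activationRegion θ J ∩ S) ∂P ≤
      c * ∫⁻ o, ENNReal.ofReal (2 * C) ^ T.card * volume (tieDomain T base J S C o)
        ∂(restLaw P T) := by
  have := isProbabilityMeasure_restLaw P T
  set F : Params n K → ENNReal := fun θ => μHE[m] (activationRegion θ J ∩ S) with hF
  calc ∫⁻ θ, F θ ∂P
      = ∫⁻ θ, (boundedGrad n K S C).indicator F (joinParams T (splitEquiv T θ)) ∂P := by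
        refine lintegral_congr_ae ?_
        filter_upwards [hgood] with θ hθ
        rw [show joinParams T (splitEquiv T θ) = θ from (splitEquiv T).left_inv θ,
          Set.indicator_of_mem hθ]
    _ = ∫⁻ p, (boundedGrad n K S C).indicator F (joinParams T p) ∂(P.map (splitParams T)) :=
        ((splitEquiv T).measurableEmbedding.lintegral_map
          (fun p => (boundedGrad n K S C).indicator F (joinParams T p))).symm
    _ ≤ ∫⁻ p, (boundedGrad n K S C).indicator F (joinParams T p)
          ∂(c • (restLaw P T).prod (volume : Measure ({i // i ∈ T} → ℝ))) :=
        lintegral_mono' (map_splitParams_le hρ hc) le_rfl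
    _ = c * ∫⁻ p, (boundedGrad n K S C).indicator F (joinParams T p)
          ∂((restLaw P T).prod (volume : Measure ({i // i ∈ T} → ℝ))) := by
        rw [lintegral_smul_measure, smul_eq_mul]
    _ ≤ c * ∫⁻ o, ∫⁻ b, (boundedGrad n K S C).indicator F (joinParams T (o, b))
          ∂volume ∂(restLaw P T) := by
        gcongr
        exact lintegral_prod_le _
    _ ≤ _ := by
        gcongr with o
        exact lintegral_activationRegion_le hbase hT hm hS (measurableSet_boundedGrad S C) o

end Expectation

/-! ### Counting partial patterns -/

lemma card_filter_mem_snd {α β : Type*} [DecidableEq β] [Fintype β] (U : Finset α)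
    (B : α → Finset β) :
    ((U ×ˢ Finset.univ).filter fun i : α × β => i.2 ∈ B i.1).card = ∑ z ∈ U, (B z).card := by
  rw [Finset.card_filter, Finset.sum_product]
  exact Finset.sum_congr rfl fun z _ => by simp

section Patterns

variable {L K : ℕ} {n : Fin (L + 1) → ℕ}

/-- The biases of the features in the pattern `J`, except for the feature with the smallest index
of each unit. -/
def tiedBiases (J : HiddenUnit n → Finset (Fin K)) : Finset (BiasIndex n K) :=
  Finset.univ.filter fun i => i.2 ∈ J i.1 ∧ ∃ j ∈ J i.1, j < i.2

lemma mem_tiedBiases {J : HiddenUnit n → Finset (Fin K)} {i : BiasIndex n K} :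
    i ∈ tiedBiases J ↔ i.2 ∈ J i.1 ∧ ∃ j ∈ J i.1, j < i.2 := by
  simp [tiedBiases]

lemma exists_base {J : HiddenUnit n → Finset (Fin K)} (hJ : ∀ z, (J z).Nonempty) :
    ∃ base : HiddenUnit n → Fin K, (∀ z, base z ∈ J z) ∧
      ∀ i : BiasIndex n K, i ∈ tiedBiases J ↔ i.2 ∈ J i.1 ∧ i.2 ≠ base i.1 := by
  refine ⟨fun z => (J z).min' (hJ z), fun z => Finset.min'_mem _ _, fun i => ?_⟩
  rw [mem_tiedBiases]
  refine and_congr_right fun hi => ⟨?_, fun hne => ?_⟩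
  · rintro ⟨j, hj, hji⟩ heq
    exact absurd (Finset.min'_le _ j hj) (not_le.2 (hji.trans_eq heq))
  · exact ⟨_, Finset.min'_mem _ (hJ i.1), lt_of_le_of_ne (Finset.min'_le _ _ hi) (Ne.symm hne)⟩

lemma card_tiedBiases {J : HiddenUnit n → Finset (Fin K)} {r : ℕ}
    (hJ : J ∈ partialPatterns n K r) : (tiedBiases J).card = r := by
  obtain ⟨base, hbase, hT⟩ := exists_base hJ.1
  have heq : tiedBiases J = (Finset.univ ×ˢ Finset.univ).filter
      fun i : BiasIndex n K => i.2 ∈ (J i.1).erase (base i.1) := by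
    ext i
    simp [hT, and_comm]
  rw [heq, card_filter_mem_snd Finset.univ fun z => (J z).erase (base z), ← hJ.2]
  exact Finset.sum_congr rfl fun z _ => Finset.card_erase_of_mem (hbase z)

lemma card_hiddenUnit (n : Fin (L + 1) → ℕ) : Fintype.card (HiddenUnit n) = numUnits n := by
  simp [numUnits]

/-- The units at which an `r`-partial pattern has ties are contained in a set of `r` units. -/
lemma exists_units {J : HiddenUnit n → Finset (Fin K)} {r : ℕ} (hJ : J ∈ partialPatterns n K r)
    (hr : r ≤ numUnits n) :
    ∃ U : Finset (HiddenUnit n), U.card = r ∧ ∀ z ∉ U, (J z).card = 1 := by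
  have hcard : (Finset.univ.filter fun z => 2 ≤ (J z).card).card ≤ r := by
    rw [← hJ.2, Finset.card_eq_sum_ones]
    refine (Finset.sum_le_sum fun z hz => ?_).trans
      (Finset.sum_le_sum_of_subset (Finset.subset_univ _))
    have := (Finset.mem_filter.1 hz).2
    omega
  obtain ⟨U, hsub, hU⟩ := Finset.exists_superset_card_eq hcard (hr.trans_eq (card_hiddenUnit n).symm)
  refine ⟨U, hU, fun z hz => ?_⟩
  have h1 := Finset.card_pos.2 (hJ.1 z)
  have h2 : ¬ 2 ≤ (J z).card := fun h => hz (hsub (by simpa using h))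
  omega

lemma card_features {J : HiddenUnit n → Finset (Fin K)} {r : ℕ} (hJ : J ∈ partialPatterns n K r)
    {U : Finset (HiddenUnit n)} (hU : U.card = r) (hJU : ∀ z ∉ U, (J z).card = 1) :
    ((U ×ˢ Finset.univ).filter fun i : BiasIndex n K => i.2 ∈ J i.1).card = 2 * r := by
  rw [card_filter_mem_snd]
  have h1 : ∑ z ∈ U, ((J z).card - 1) = r := by
    rw [← hJ.2]
    exact Finset.sum_subset (Finset.subset_univ _) fun z _ hz => by rw [hJU z hz, Nat.sub_self]
  have h2 : ∑ z ∈ U, (J z).card = ∑ z ∈ U, (((J z).card - 1) + 1) :=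
    Finset.sum_congr rfl fun z _ => by
      have := Finset.card_pos.2 (hJ.1 z)
      omega
  rw [h2, Finset.sum_add_distrib, h1, Finset.sum_const, hU, smul_eq_mul]
  omega

lemma activationRegion_disjoint {θ : Params n K} {J J' : HiddenUnit n → Finset (Fin K)}
    (hne : J ≠ J') : Disjoint (activationRegion θ J) (activationRegion θ J') := by
  refine Set.disjoint_left.2 fun x hx hx' => hne (funext fun z => Finset.ext fun k => ?_)
  rw [← mem_activationRegion.1 hx, ← mem_activationRegion.1 hx']

lemma measurableSet_activationRegion_section (θ : Params n K)
    (J : HiddenUnit n → Finset (Fin K)) : MeasurableSet (activationRegion θ J) :=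
  measurableSet_region_comp J (measurable_const (a := θ))

lemma tieDomain_disjoint {T : Finset (BiasIndex n K)} {base base' : HiddenUnit n → Fin K}
    {J J' : HiddenUnit n → Finset (Fin K)} {S : Set (EuclideanSpace ℝ (Fin (n 0)))} {C : ℝ}
    {o : (WeightIndex n K → ℝ) × ({i // i ∉ T} → ℝ)}
    (hJ : ∀ z, (J z = J' z ∧ ∃ k ∈ J z, (z, k) ∉ T) ∨ ∀ k, (z, k) ∉ T) (hne : J ≠ J') :
    Disjoint (tieDomain T base J S C o) (tieDomain T base' J' S C o) := by
  refine Set.disjoint_left.2 fun x hx hx' => hne ?_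
  have key : ∀ b b' : {i // i ∈ T} → ℝ, x ∈ activationRegion (joinParams T (o, b)) J →
      x ∈ activationRegion (joinParams T (o, b')) J' → J = J' := fun b b' hb hb' =>
    pattern_unique (θ := joinParams T (o, b)) (θ' := joinParams T (o, b')) rfl
      (fun i hi => (joinParams_snd_of_notMem (o, b) hi).trans
        (joinParams_snd_of_notMem (o, b') hi).symm) hb hb' hJ
  exact key _ _ hx.2.1 hx'.2.1

/-- The expected total volume of the activation regions of a family of `r`-partial patterns which
agree at the units in `U` and have no ties at the other units. -/
lemma sum_lintegral_activationRegion_le {r m : ℕ} (hm : r + m = n 0)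
    {S : Set (EuclideanSpace ℝ (Fin (n 0)))} (hS : MeasurableSet S)
    (P : Measure (Params n K)) [IsProbabilityMeasure P] {C B : ℝ}
    (hgood : ∀ᵐ θ ∂P, θ ∈ boundedGrad n K S C)
    (h_biases : ∀ T : Finset (BiasIndex n K), ∃ ρ, IsBiasCondDensity P T ρ)
    (h_bias : ∀ (T : Finset (BiasIndex n K)) ρ, IsBiasCondDensity P T ρ →
      ∀ᵐ o ∂(restLaw P T), ∀ᵐ b ∂(volume : Measure ({i // i ∈ T} → ℝ)),
        ρ (o, b) ≤ ENNReal.ofReal (B ^ T.card))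
    (s : Finset (HiddenUnit n → Finset (Fin K))) (hs : ∀ J ∈ s, J ∈ partialPatterns n K r)
    (U : Finset (HiddenUnit n)) (hU1 : ∀ J ∈ s, ∀ z ∉ U, (J z).card = 1)
    (hU2 : ∀ J ∈ s, ∀ J' ∈ s, ∀ z ∈ U, J z = J' z) :
    ∑ J ∈ s, ∫⁻ θ, μHE[m] (activationRegion θ J ∩ S) ∂P ≤
      ENNReal.ofReal (B ^ r) * (ENNReal.ofReal (2 * C) ^ r * volume S) := by
  rcases s.eq_empty_or_nonempty with rfl | ⟨J₀, hJ₀⟩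
  · simp
  set T := tiedBiases J₀ with hTdef
  have hcardT : T.card = r := card_tiedBiases (hs J₀ hJ₀)
  have hnotU : ∀ J ∈ s, ∀ z ∉ U, ∀ k, (z, k) ∉ tiedBiases J := by
    intro J hJ z hz k hk
    obtain ⟨h1, j, h2, h3⟩ := mem_tiedBiases.1 hk
    exact h3.ne (Finset.card_le_one.1 (hU1 J hJ z hz).le j h2 k h1)
  have hTJ : ∀ J ∈ s, tiedBiases J = T := by
    intro J hJ
    ext ⟨z, k⟩
    by_cases hz : z ∈ U
    · rw [hTdef, mem_tiedBiases, mem_tiedBiases, hU2 J hJ J₀ hJ₀ z hz]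
    · simp only [hnotU J hJ z hz k, hTdef, hnotU J₀ hJ₀ z hz k]
  have hbase : ∀ J, ∃ base : HiddenUnit n → Fin K, J ∈ s → (∀ z, base z ∈ J z) ∧
      ∀ i : BiasIndex n K, i ∈ T ↔ i.2 ∈ J i.1 ∧ i.2 ≠ base i.1 := by
    intro J
    by_cases hJ : J ∈ s
    · obtain ⟨base, h1, h2⟩ := exists_base (hs J hJ).1
      exact ⟨base, fun _ => ⟨h1, hTJ J hJ ▸ h2⟩⟩
    · exact ⟨(exists_base (hs J₀ hJ₀).1).choose, fun h => absurd h hJ⟩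
  choose base hbase using hbase
  obtain ⟨ρ, hρ⟩ := h_biases T
  have := isProbabilityMeasure_restLaw P T
  have hdisj : ∀ o, ∑ J ∈ s, volume (tieDomain T (base J) J S C o) ≤ volume S := by
    intro o
    rw [← measure_biUnion_finset]
    · exact measure_mono (Set.iUnion₂_subset fun J _ x hx => hx.1)
    · intro J hJ J' hJ' hne
      refine tieDomain_disjoint (fun z => ?_) hne
      by_cases hz : z ∈ U
      · refine .inl ⟨hU2 J hJ J' hJ' z hz, base J z, (hbase J hJ).1 z, fun h => ?_⟩
        exact (((hbase J hJ).2 _).1 h).2 rfl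
      · exact .inr fun k => hTJ J hJ ▸ hnotU J hJ z hz k
    · exact fun J _ => measurableSet_tieDomain hS (measurableSet_boundedGrad S C) o
  calc ∑ J ∈ s, ∫⁻ θ, μHE[m] (activationRegion θ J ∩ S) ∂P
      ≤ ∑ J ∈ s, ENNReal.ofReal (B ^ r) * ∫⁻ o, ENNReal.ofReal (2 * C) ^ r *
          volume (tieDomain T (base J) J S C o) ∂(restLaw P T) := by
        refine Finset.sum_le_sum fun J hJ => ?_
        have := lintegral_volume_activationRegion_le (hbase J hJ).1 (hbase J hJ).2
          (hcardT.symm ▸ hm) hS P hgood hρ (h_bias T ρ hρ)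
        rwa [hcardT] at this
    _ ≤ ENNReal.ofReal (B ^ r) * ∫⁻ _, ENNReal.ofReal (2 * C) ^ r * volume S ∂(restLaw P T) := by
        rw [← Finset.mul_sum]
        gcongr
        refine (sum_lintegral_le_lintegral_sum _ _ _).trans (lintegral_mono fun o => ?_)
        rw [← Finset.mul_sum]
        gcongr
        exact hdisj o
    _ = _ := by
        rw [lintegral_const, measure_univ, mul_one]

end Patterns

end Maxout
end

/-- Upper bound on the expected volume of the non-linear locus of a random maxout network. -/
theorem theorem4 {L : ℕ} (n : Fin (L + 1) → ℕ) (K : ℕ)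
    (P : Measure (Maxout.Params n K)) [IsProbabilityMeasure P]
    (S : Set (EuclideanSpace ℝ (Fin (n 0))))
    (hS_bounded : Bornology.IsBounded S) (hS_meas : MeasurableSet S)
    (Cgrad Cbias : ℝ) (hCgrad : 0 < Cgrad) (hCbias : 0 < Cbias)
    -- the weights have a joint density
    (h_weights : P.map Prod.fst ≪ (volume : Measure (Maxout.WeightIndex n K → ℝ)))
    -- every collection of biases has a conditional density given all other parameters
    (h_biases : ∀ T : Finset (Maxout.BiasIndex n K), ∃ ρ, Maxout.IsBiasCondDensity P T ρ)
    -- moment bounds for the gradients of the pre-activation features, over `S`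
    (h_grad : ∀ (t : ℕ) (z : Maxout.HiddenUnit n) (k : Fin K),
      (⨆ x ∈ S, ∫⁻ θ, ‖gradient (Maxout.feature θ z k) x‖ₑ ^ t ∂P) ≤ ENNReal.ofReal (Cgrad ^ t))
    -- bounds for the conditional densities of all collections of biases
    (h_bias : ∀ (T : Finset (Maxout.BiasIndex n K)) ρ, Maxout.IsBiasCondDensity P T ρ →
      ∀ᵐ o ∂(Maxout.restLaw P T), ∀ᵐ b ∂(volume : Measure ({i // i ∈ T} → ℝ)),
        ρ (o, b) ≤ ENNReal.ofReal (Cbias ^ T.card))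
    (r : ℕ) (hr_pos : 1 ≤ r) (hr_dim : r ≤ n 0) (hr_units : r ≤ Maxout.numUnits n) :
    AEMeasurable (fun θ => μHE[n 0 - r] (Maxout.partialLocus θ r ∩ S)) P ∧
      (∫⁻ θ, μHE[n 0 - r] (Maxout.partialLocus θ r ∩ S) ∂P) / volume S ≤
        ENNReal.ofReal ((2 * Cgrad * Cbias) ^ r * (Nat.choose (r * K) (2 * r) : ℝ) *
          (Nat.choose (Maxout.numUnits n) r : ℝ)) := by
  classical
  let patterns : Finset (Maxout.HiddenUnit n → Finset (Fin K)) :=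
    Finset.univ.filter fun J => J ∈ Maxout.partialPatterns n K r
  have hpat : ∀ J ∈ patterns, J ∈ Maxout.partialPatterns n K r := fun J hJ =>
    (Finset.mem_filter.1 hJ).2
  have hm : r + (n 0 - r) = n 0 := Nat.add_sub_cancel' hr_dim
  have hgood := Maxout.ae_mem_boundedGrad P hS_meas hCgrad h_grad
  have hsum : ∀ θ : Maxout.Params n K, μHE[n 0 - r] (Maxout.partialLocus θ r ∩ S) =
      ∑ J ∈ patterns, μHE[n 0 - r] (Maxout.activationRegion θ J ∩ S) := by
    intro θ
    rw [← measure_biUnion_finset]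
    · congr 1
      ext x
      simp [Maxout.partialLocus, patterns]
      tauto
    · exact fun J _ J' _ hne => (Maxout.activationRegion_disjoint hne).mono
        Set.inter_subset_left Set.inter_subset_left
    · exact fun J _ => (Maxout.measurableSet_activationRegion_section θ J).inter hS_meas
  have hae : ∀ J ∈ patterns,
      AEMeasurable (fun θ => μHE[n 0 - r] (Maxout.activationRegion θ J ∩ S)) P := by
    intro J hJ
    obtain ⟨base, hbase, hT⟩ := Maxout.exists_base (hpat J hJ).1
    obtain ⟨ρ, hρ⟩ := h_biases (Maxout.tiedBiases J)
    exact Maxout.aemeasurable_volume_activationRegion hbase hT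
      ((Maxout.card_tiedBiases (hpat J hJ)).symm ▸ hm) hS_meas P hρ
  simp only [hsum]
  refine ⟨Finset.aemeasurable_fun_sum _ hae, ENNReal.div_le_of_le_mul ?_⟩
  rw [lintegral_finsetSum' _ hae]
  -- group the patterns by a set of `r` units outside which they have no ties, and by the set of
  -- the `2 * r` features of these units which belong to the pattern
  have hunits : ∀ J, ∃ U : Finset (Maxout.HiddenUnit n), J ∈ patterns →
      U.card = r ∧ ∀ z ∉ U, (J z).card = 1 := by
    intro J
    by_cases hJ : J ∈ patterns
    · obtain ⟨U, hU⟩ := Maxout.exists_units (hpat J hJ) hr_units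
      exact ⟨U, fun _ => hU⟩
    · exact ⟨∅, fun h => absurd h hJ⟩
  choose U hU using hunits
  let key : (Maxout.HiddenUnit n → Finset (Fin K)) →
      Σ _ : Finset (Maxout.HiddenUnit n), Finset (Maxout.BiasIndex n K) := fun J =>
    ⟨U J, (U J ×ˢ Finset.univ).filter fun i => i.2 ∈ J i.1⟩
  let keys : Finset (Σ _ : Finset (Maxout.HiddenUnit n), Finset (Maxout.BiasIndex n K)) :=
    (Finset.powersetCard r Finset.univ).sigma fun U =>
      Finset.powersetCard (2 * r) (U ×ˢ Finset.univ)
  have hkey : ∀ J ∈ patterns, key J ∈ keys := by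
    intro J hJ
    refine Finset.mem_sigma.2 ⟨Finset.mem_powersetCard.2 ⟨Finset.subset_univ _, (hU J hJ).1⟩,
      Finset.mem_powersetCard.2 ⟨Finset.filter_subset _ _, ?_⟩⟩
    exact Maxout.card_features (hpat J hJ) (hU J hJ).1 (hU J hJ).2
  have hcard : keys.card = Nat.choose (Maxout.numUnits n) r * Nat.choose (r * K) (2 * r) := by
    rw [Finset.card_sigma, Finset.sum_congr rfl (g := fun _ => Nat.choose (r * K) (2 * r)),
      Finset.sum_const, Finset.card_powersetCard, Finset.card_univ, Maxout.card_hiddenUnit,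
      smul_eq_mul]
    intro U hU
    rw [Finset.card_powersetCard, Finset.card_product, (Finset.mem_powersetCard.1 hU).2,
      Finset.card_univ, Fintype.card_fin]
  calc ∑ J ∈ patterns, ∫⁻ θ, μHE[n 0 - r] (Maxout.activationRegion θ J ∩ S) ∂P
      = ∑ c ∈ keys, ∑ J ∈ patterns with key J = c,
          ∫⁻ θ, μHE[n 0 - r] (Maxout.activationRegion θ J ∩ S) ∂P :=
        (Finset.sum_fiberwise_of_maps_to hkey _).symm
    _ ≤ ∑ c ∈ keys, ENNReal.ofReal (Cbias ^ r) * (ENNReal.ofReal (2 * Cgrad) ^ r * volume S) := by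
        refine Finset.sum_le_sum fun c _ => ?_
        refine Maxout.sum_lintegral_activationRegion_le hm hS_meas P hgood h_biases h_bias _
          (fun J hJ => hpat J (Finset.mem_filter.1 hJ).1) c.1 ?_ ?_
        · intro J hJ z hz
          obtain ⟨hJ, hJc⟩ := Finset.mem_filter.1 hJ
          have h1 : U J = c.1 := congrArg Sigma.fst hJc
          exact (hU J hJ).2 z (h1 ▸ hz)
        · intro J hJ J' hJ' z hz
          obtain ⟨hJ, hJc⟩ := Finset.mem_filter.1 hJ
          obtain ⟨hJ', hJc'⟩ := Finset.mem_filter.1 hJ'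
          have h1 : U J = c.1 := congrArg Sigma.fst hJc
          have h2 : U J' = c.1 := congrArg Sigma.fst hJc'
          have h3 : (key J).2 = (key J').2 := congrArg Sigma.snd (hJc.trans hJc'.symm)
          ext k
          have := Finset.ext_iff.1 h3 (z, k)
          simpa [key, h1, h2, hz] using this
    _ = ENNReal.ofReal ((2 * Cgrad * Cbias) ^ r * (Nat.choose (r * K) (2 * r) : ℝ) *
          (Nat.choose (Maxout.numUnits n) r : ℝ)) * volume S := by
        rw [Finset.sum_const, hcard, nsmul_eq_mul,
          ENNReal.ofReal_mul (q := (Nat.choose (Maxout.numUnits n) r : ℝ)) (by positivity),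
          ENNReal.ofReal_mul (q := (Nat.choose (r * K) (2 * r) : ℝ)) (by positivity),
          ENNReal.ofReal_natCast, ENNReal.ofReal_natCast, mul_pow (2 * Cgrad),
          ENNReal.ofReal_mul (q := Cbias ^ r) (by positivity),
          ENNReal.ofReal_pow (p := 2 * Cgrad) (by positivity)]
        push_cast
        ring
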